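/- Let $\mathbb K\in\{\mathbb R,\mathbb C\}$, let $(\Omega,\mathcal F,\mu)$ be a $\sigma$-finite measure space with $\mu(\Omega)>0$, let $L^0(\mathcal F,\mathbb K)$ be the algebra of classes of a.e. equal measurable functions $\Omega\to\mathbb K$, and let $L^0_+(\mathcal F)$ be the set of nonnegative elements of $L^0(\mathcal F,\mathbb R)$, ordered a.e. An RN module $(S,\|\cdot\|)$ over $\mathbb K$ with base $(\Omega,\mathcal F,\mu)$ is an $L^0(\mathcal F,\mathbb K)$-module $S$ with a map $\|\cdot\|:S\to L^0_+(\mathcal F)$ such that $\|x\|=0$ iff $x=0$, $\|\xi x\|=|\xi|\,\|x\|$ and $\|x+y\|\le\|x\|+\|y\|$. It is $\mathcal T_{\varepsilon,\lambda}$-complete if it is complete for the uniformity with base $\{(x,y):P_\mu(\|x-y\|<\varepsilon)>1-\lambda\}$ ($\varepsilon>0$, $0<\lambda<1$), where $P_\mu$ is a probability measure with the same null sets as $\mu$. For $r\in[1,\infty]$ let $L^r(S)=\{x\in S: |||x|||_r:=|\,\|x\|\,|_r<\infty\}$, where $|\cdot|_r$ is the usual $L^r(\mu)$-norm; this is a normed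 module over $L^\infty(\mathcal F,\mathbb K)$. The random conjugate space $S^*$ is the RN module of all $\mathbb K$-linear $F:S\to L^0(\mathcal F,\mathbb K)$ for which there is $\xi\in L^0_+(\mathcal F)$ with $|F(x)|\le\xi\|x\|$ for all $x\in S$, with $\|F\|$ the infimum in $L^0$ of all such $\xi$. For a normed module $\mathcal M$ over $L^\infty(\mathcal F,\mathbb K)$ with norm $|||\cdot|||$, the module dual $\mathcal M^*_m$ is the set of continuous $L^\infty(\mathcal F,\mathbb K)$-linear maps $f:\mathcal M\to L^1(\mathcal F,\mathbb K)$, with norm $|||f|||=\sup\{\int_\Omega|f(x)|\,d\mu: x\in\mathcal M,\ |||x|||\le1\}$. **Proposition 3.13.** Let $(S,\|\cdot\|)$ be a $\mathcal T_{\varepsilon,\lambda}$-complete RN module over $\mathbb K$ with base $(\Omega,\mathcal F,\mu)$, let $1\le p\le\infty$, let $q\in[1,\infty]$ satisfy $\frac1p+\frac1q=1$, and let $\mathcal M$ be an $L^\infty(\mathcal F,\mathbb K)$-submodule of $L^p(S)$, with the norm $|||\cdot|||_p$. Then for every $f\in\mathcal M^*_m$ there exists $F\in L^q(S^*)$ whose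 restriction to $L^p(S)$ is an element $\Phi$ of $(L^p(S))^*_m$ such that $\Phi|_{\mathcal M}=f$ and $$|||F|||_q=|||\Phi|||=|||f|||=\sup\Big\{\int_\Omega|f(x)|\,d\mu: x\in\mathcal M,\ |||x|||_p\le1\Big\}.$$ -/

import Mathlib

open MeasureTheory Filter Topology
open scoped ENNReal

namespace RandomNormed

noncomputable section

variable {𝕜 : Type*} [RCLike 𝕜] {Ω : Type*} [MeasurableSpace Ω] {μ : Measure Ω}

/-! ### The algebra `L⁰(F, 𝕜)` and its subalgebra `L^∞(F, 𝕜)`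

`Ω →ₘ[μ] 𝕜` is Mathlib's space of classes of a.e. equal measurable functions; Mathlib provides its
additive group, its multiplicative monoid, its `𝕜`-module structure and its a.e. order. -/

/-- `L⁰(F, 𝕜)` is a commutative ring under the (a.e.) pointwise operations. -/
instance instCommRingL0 : CommRing (Ω →ₘ[μ] 𝕜) :=
  { (AEEqFun.instAddCommGroup : AddCommGroup (Ω →ₘ[μ] 𝕜)),
    (AEEqFun.instCommMonoid : CommMonoid (Ω →ₘ[μ] 𝕜)) with
    left_distrib := fun a b c => by
      apply AEEqFun.ext
      filter_upwards [AEEqFun.coeFn_mul a (b + c), AEEqFun.coeFn_add b c, AEEqFun.coeFn_mul a b,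
        AEEqFun.coeFn_mul a c, AEEqFun.coeFn_add (a * b) (a * c)] with ω h1 h2 h3 h4 h5
      simp only [Pi.mul_apply, Pi.add_apply] at *
      rw [h1, h2, h5, h3, h4, mul_add]
    right_distrib := fun a b c => by
      apply AEEqFun.ext
      filter_upwards [AEEqFun.coeFn_mul (a + b) c, AEEqFun.coeFn_add a b, AEEqFun.coeFn_mul a c,
        AEEqFun.coeFn_mul b c, AEEqFun.coeFn_add (a * c) (b * c)] with ω h1 h2 h3 h4 h5
      simp only [Pi.mul_apply, Pi.add_apply] at *
      rw [h1, h2, h5, h3, h4, add_mul]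
    zero_mul := fun a => by
      apply AEEqFun.ext
      filter_upwards [AEEqFun.coeFn_mul 0 a, AEEqFun.coeFn_zero (μ := μ) (β := 𝕜)] with ω h1 h2
      simp only [Pi.mul_apply, Pi.zero_apply] at *
      rw [h1, h2, zero_mul]
    mul_zero := fun a => by
      apply AEEqFun.ext
      filter_upwards [AEEqFun.coeFn_mul a 0, AEEqFun.coeFn_zero (μ := μ) (β := 𝕜)] with ω h1 h2
      simp only [Pi.mul_apply, Pi.zero_apply] at *
      rw [h1, h2, mul_zero] }

/-- `L⁰(F, 𝕜)` is an algebra over `𝕜`, for Mathlib's scalar multiplication. -/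
instance instAlgebraL0 : Algebra 𝕜 (Ω →ₘ[μ] 𝕜) :=
  Algebra.ofModule
    (fun r x y => by
      apply AEEqFun.ext
      filter_upwards [AEEqFun.coeFn_mul (r • x) y, AEEqFun.coeFn_smul r x,
        AEEqFun.coeFn_smul r (x * y), AEEqFun.coeFn_mul x y] with ω h1 h2 h3 h4
      simp only [Pi.mul_apply, Pi.smul_apply, smul_eq_mul] at *
      rw [h1, h2, h3, h4, mul_assoc])
    (fun r x y => by
      apply AEEqFun.ext
      filter_upwards [AEEqFun.coeFn_mul x (r • y), AEEqFun.coeFn_smul r y,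
        AEEqFun.coeFn_smul r (x * y), AEEqFun.coeFn_mul x y] with ω h1 h2 h3 h4
      simp only [Pi.mul_apply, Pi.smul_apply, smul_eq_mul] at *
      rw [h1, h2, h3, h4, mul_left_comm])

/-- The modulus `|ξ| ∈ L⁰₊(F)` of `ξ ∈ L⁰(F, 𝕜)`. -/
def modulus (ξ : Ω →ₘ[μ] 𝕜) : Ω →ₘ[μ] ℝ :=
  AEEqFun.comp (fun z : 𝕜 => ‖z‖) continuous_norm ξ

theorem coeFn_modulus (ξ : Ω →ₘ[μ] 𝕜) : modulus ξ =ᵐ[μ] fun ω => ‖ξ ω‖ :=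
  AEEqFun.coeFn_comp _ _ _

theorem coeFn_mul' (a b : Ω →ₘ[μ] 𝕜) : ∀ᵐ ω ∂μ, (a * b) ω = a ω * b ω :=
  AEEqFun.coeFn_mul a b

variable (𝕜 μ) in
/-- The classes of essentially bounded measurable functions, as a subalgebra of `L⁰(F, 𝕜)`. -/
def linftySubalgebra : Subalgebra 𝕜 (Ω →ₘ[μ] 𝕜) where
  carrier := {ξ | eLpNorm ξ ∞ μ < ∞}
  mul_mem' := by
    intro a b ha hb
    have h : MemLp (⇑a * ⇑b) ∞ μ :=
      MemLp.mul (p := ∞) (q := ∞) (r := ∞) ⟨b.aestronglyMeasurable, hb⟩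
        ⟨a.aestronglyMeasurable, ha⟩
    have := h.2
    rwa [← eLpNorm_congr_ae (AEEqFun.coeFn_mul a b)] at this
  add_mem' := by
    intro a b ha hb
    exact (Lp 𝕜 ∞ μ).add_mem (x := a) (y := b) (Lp.mem_Lp_iff_eLpNorm_lt_top.2 ha)
      (Lp.mem_Lp_iff_eLpNorm_lt_top.2 hb) |> Lp.mem_Lp_iff_eLpNorm_lt_top.1
  algebraMap_mem' := by
    intro r
    have h : (algebraMap 𝕜 (Ω →ₘ[μ] 𝕜) r) =ᵐ[μ] fun _ => r := by
      rw [Algebra.algebraMap_eq_smul_one]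
      filter_upwards [AEEqFun.coeFn_smul r (1 : Ω →ₘ[μ] 𝕜), AEEqFun.coeFn_one (μ := μ) (β := 𝕜)]
        with ω h1 h2
      rw [h1, Pi.smul_apply, h2]
      simp
    show eLpNorm _ ∞ μ < ∞
    rw [eLpNorm_congr_ae h]
    exact (memLp_top_const r).2

variable (𝕜 μ) in
/-- The algebra `L^∞(F, 𝕜)`. -/
def LInfty : Type _ := linftySubalgebra 𝕜 μ

instance instCommRingLInfty : CommRing (LInfty 𝕜 μ) :=
  inferInstanceAs (CommRing (linftySubalgebra 𝕜 μ))

instance instAlgebraLInfty : Algebra 𝕜 (LInfty 𝕜 μ) :=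
  inferInstanceAs (Algebra 𝕜 (linftySubalgebra 𝕜 μ))

variable (𝕜 μ) in
/-- The inclusion of `L^∞(F, 𝕜)` in `L⁰(F, 𝕜)`. -/
def LInfty.toL0 : LInfty 𝕜 μ →ₐ[𝕜] (Ω →ₘ[μ] 𝕜) := (linftySubalgebra 𝕜 μ).val

theorem LInfty.eLpNorm_toL0_lt_top (ξ : LInfty 𝕜 μ) :
    eLpNorm (LInfty.toL0 𝕜 μ ξ) ∞ μ < ∞ := ξ.2

theorem eLpNorm_mul_lt_top {p : ℝ≥0∞} {ξ g : Ω →ₘ[μ] 𝕜} (hξ : eLpNorm ξ ∞ μ < ∞)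
    (hg : eLpNorm g p μ < ∞) : eLpNorm (ξ * g) p μ < ∞ := by
  have h : MemLp (⇑ξ * ⇑g) p μ :=
    MemLp.mul (p := ∞) (q := p) (r := p) ⟨g.aestronglyMeasurable, hg⟩
      ⟨ξ.aestronglyMeasurable, hξ⟩
  rw [eLpNorm_congr_ae (AEEqFun.coeFn_mul ξ g)]
  exact h.2

/-- Pointwise multiplication makes the Banach space `L^p(F, 𝕜)` a module over `L^∞(F, 𝕜)`. -/
instance instModuleLp (p : ℝ≥0∞) : Module (LInfty 𝕜 μ) (Lp 𝕜 p μ) where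
  smul ξ g := ⟨LInfty.toL0 𝕜 μ ξ * (g : Ω →ₘ[μ] 𝕜), Lp.mem_Lp_iff_eLpNorm_lt_top.2
    (eLpNorm_mul_lt_top ξ.eLpNorm_toL0_lt_top (Lp.mem_Lp_iff_eLpNorm_lt_top.1 g.2))⟩
  one_smul g := Subtype.ext (by
    show LInfty.toL0 𝕜 μ 1 * (g : Ω →ₘ[μ] 𝕜) = g
    rw [map_one, one_mul])
  mul_smul ξ η g := Subtype.ext (by
    show LInfty.toL0 𝕜 μ (ξ * η) * (g : Ω →ₘ[μ] 𝕜) =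
      LInfty.toL0 𝕜 μ ξ * (LInfty.toL0 𝕜 μ η * (g : Ω →ₘ[μ] 𝕜))
    rw [map_mul, mul_assoc])
  smul_zero ξ := Subtype.ext (mul_zero (LInfty.toL0 𝕜 μ ξ))
  smul_add ξ g h := Subtype.ext
    (mul_add (LInfty.toL0 𝕜 μ ξ) (g : Ω →ₘ[μ] 𝕜) (h : Ω →ₘ[μ] 𝕜))
  add_smul ξ η g := Subtype.ext (by
    show LInfty.toL0 𝕜 μ (ξ + η) * (g : Ω →ₘ[μ] 𝕜) =
      LInfty.toL0 𝕜 μ ξ * (g : Ω →ₘ[μ] 𝕜) + LInfty.toL0 𝕜 μ η * (g : Ω →ₘ[μ] 𝕜)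
    rw [map_add, add_mul])
  zero_smul g := Subtype.ext (by
    show LInfty.toL0 𝕜 μ 0 * (g : Ω →ₘ[μ] 𝕜) = 0
    rw [map_zero, zero_mul])

/-! ### Random normed modules -/

/-- A random normed module (RN module) over `𝕜` with base `(Ω, F, μ)`: a module over the algebra
`L⁰(F, 𝕜)` (the `𝕜`-linear structure is the one coming from the algebra structure of `L⁰(F, 𝕜)`)
with an `L⁰`-norm `‖·‖ : S → L⁰₊(F)`. -/
class RNModule (𝕜 : Type*) [RCLike 𝕜] {Ω : Type*} [MeasurableSpace Ω] (μ : Measure Ω)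
    (S : Type*) [AddCommGroup S] [Module 𝕜 S] [Module (Ω →ₘ[μ] 𝕜) S]
    [IsScalarTower 𝕜 (Ω →ₘ[μ] 𝕜) S] where
  /-- The `L⁰`-norm. -/
  rnorm : S → (Ω →ₘ[μ] ℝ)
  rnorm_nonneg : ∀ x, 0 ≤ rnorm x
  rnorm_eq_zero_iff : ∀ x, rnorm x = 0 ↔ x = 0
  rnorm_smul : ∀ (ξ : Ω →ₘ[μ] 𝕜) (x : S), rnorm (ξ • x) = modulus ξ * rnorm x
  rnorm_add_le : ∀ x y, rnorm (x + y) ≤ rnorm x + rnorm y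

section RN

variable (𝕜 μ) (S : Type*) [AddCommGroup S] [Module 𝕜 S] [Module (Ω →ₘ[μ] 𝕜) S]
  [IsScalarTower 𝕜 (Ω →ₘ[μ] 𝕜) S] [RNModule 𝕜 μ S]

variable {S} in
/-- The `L⁰`-norm `‖x‖ ∈ L⁰₊(F)` of an element of an RN module. -/
def rn (x : S) : Ω →ₘ[μ] ℝ := RNModule.rnorm 𝕜 x

variable {S} in
theorem rn_neg (x : S) : rn 𝕜 μ (-x) = rn 𝕜 μ x := by
  have h : -x = (-1 : Ω →ₘ[μ] 𝕜) • x := by simp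
  rw [h, rn, RNModule.rnorm_smul]
  apply AEEqFun.ext
  filter_upwards [coeFn_mul' (modulus (-1 : Ω →ₘ[μ] 𝕜)) (RNModule.rnorm 𝕜 x),
    coeFn_modulus (-1 : Ω →ₘ[μ] 𝕜), AEEqFun.coeFn_neg (1 : Ω →ₘ[μ] 𝕜),
    AEEqFun.coeFn_one (μ := μ) (β := 𝕜)] with ω h1 h2 h3 h4
  rw [h1, h2, h3, Pi.neg_apply, h4]
  simp [rn]

variable {S} in
theorem coeFn_rn_nonneg (x : S) : ∀ᵐ ω ∂μ, 0 ≤ rn 𝕜 μ x ω := by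
  filter_upwards [AEEqFun.coeFn_le.2 (RNModule.rnorm_nonneg (𝕜 := 𝕜) (μ := μ) x),
    AEEqFun.coeFn_zero (μ := μ) (β := ℝ)] with ω h1 h2
  rw [h2] at h1
  exact h1

variable {S} in
theorem coeFn_rn_add_le (x y : S) : ∀ᵐ ω ∂μ, rn 𝕜 μ (x + y) ω ≤ rn 𝕜 μ x ω + rn 𝕜 μ y ω := by
  filter_upwards [AEEqFun.coeFn_le.2 (RNModule.rnorm_add_le (𝕜 := 𝕜) (μ := μ) x y),
    AEEqFun.coeFn_add (rn 𝕜 μ x) (rn 𝕜 μ y)] with ω h1 h2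
  exact h1.trans_eq h2

variable {S} in
theorem eLpNorm_rn_add_le {p : ℝ≥0∞} (hp : 1 ≤ p) (x y : S) :
    eLpNorm (rn 𝕜 μ (x + y)) p μ ≤ eLpNorm (rn 𝕜 μ x) p μ + eLpNorm (rn 𝕜 μ y) p μ := by
  have h := eLpNorm_add_le (rn 𝕜 μ x).aestronglyMeasurable (rn 𝕜 μ y).aestronglyMeasurable hp
  refine le_trans (eLpNorm_mono_ae (g := ⇑(rn 𝕜 μ x) + ⇑(rn 𝕜 μ y)) ?_) h
  filter_upwards [coeFn_rn_add_le 𝕜 μ x y, coeFn_rn_nonneg 𝕜 μ (x + y)] with ω h1 h2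
  rw [Real.norm_of_nonneg h2, Pi.add_apply]
  exact h1.trans (le_abs_self _)

/-! ### The `(ε, λ)`-uniformity -/

variable {S} in
/-- The entourage `U(ε, λ) = {(x, y) : P_μ {ω : ‖x - y‖ ω < ε} > 1 - λ}`. Here `P_μ` is Mathlib's
`μ.toFinite`, a probability measure having the same null sets as the nonzero σ-finite measure `μ`
(and equal to `μ / μ Ω` if `μ` is finite); the uniformity does not depend on the choice of such a
probability measure. -/
def entourage [SigmaFinite μ] (ε l : ℝ) : Set (S × S) :=
  {z | 1 - l < μ.toFinite.real {ω | rn 𝕜 μ (z.1 - z.2) ω < ε}}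

variable {S} in
theorem entourage_comp [SigmaFinite μ] [NeZero μ] {ε l : ℝ} {x y z : S}
    (hxy : (x, y) ∈ entourage 𝕜 μ (S := S) (ε / 2) (l / 2))
    (hyz : (y, z) ∈ entourage 𝕜 μ (S := S) (ε / 2) (l / 2)) :
    (x, z) ∈ entourage 𝕜 μ (S := S) ε l := by
  simp only [entourage, Set.mem_ofPred_eq] at *
  set P := μ.toFinite
  set A := {ω | rn 𝕜 μ (x - y) ω < ε / 2}
  set B := {ω | rn 𝕜 μ (y - z) ω < ε / 2}
  have hB : MeasurableSet B :=
    measurableSet_lt (rn 𝕜 μ (y - z)).measurable measurable_const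
  have h1 : P.real (A ∪ B) + P.real (A ∩ B) = P.real A + P.real B :=
    measureReal_union_add_inter hB
  have h2 : P.real (A ∪ B) ≤ 1 := measureReal_le_one
  have h3 : P.real (A ∩ B) ≤ P.real {ω | rn 𝕜 μ (x - z) ω < ε} := by
    have h : (A ∩ B : Set Ω) ≤ᵐ[P] {ω | rn 𝕜 μ (x - z) ω < ε} := by
      refine (toFinite_absolutelyContinuous μ).ae_le ?_
      filter_upwards [coeFn_rn_add_le 𝕜 μ (x - y) (y - z)] with ω hω
      rintro ⟨ha, hb⟩
      have ha' : rn 𝕜 μ (x - y) ω < ε / 2 := ha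
      have hb' : rn 𝕜 μ (y - z) ω < ε / 2 := hb
      rw [sub_add_sub_cancel] at hω
      show rn 𝕜 μ (x - z) ω < ε
      linarith
    exact ENNReal.toReal_mono (measure_ne_top _ _) (measure_mono_ae h)
  linarith

theorem entourage_mono [SigmaFinite μ] {ε ε' l l' : ℝ} (hε : ε ≤ ε') (hl : l ≤ l') :
    entourage 𝕜 μ (S := S) ε l ⊆ entourage 𝕜 μ ε' l' := by
  intro z hz
  simp only [entourage, Set.mem_ofPred_eq] at *
  have : μ.toFinite.real {ω | rn 𝕜 μ (z.1 - z.2) ω < ε} ≤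
      μ.toFinite.real {ω | rn 𝕜 μ (z.1 - z.2) ω < ε'} :=
    measureReal_mono (fun ω hω => lt_of_lt_of_le hω hε)
  linarith

/-- The sets `U(ε, λ)`, `ε > 0`, `0 < λ < 1`, form a filter basis. -/
def entourageBasis [SigmaFinite μ] : FilterBasis (S × S) where
  sets := {U | ∃ ε l : ℝ, 0 < ε ∧ 0 < l ∧ l < 1 ∧ U = entourage 𝕜 μ ε l}
  nonempty := ⟨_, 1, 1 / 2, by norm_num, by norm_num, by norm_num, rfl⟩
  inter_sets := by
    rintro _ _ ⟨ε, l, h1, h2, h3, rfl⟩ ⟨ε', l', h1', h2', h3', rfl⟩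
    exact ⟨_, ⟨min ε ε', min l l', lt_min h1 h1', lt_min h2 h2', min_lt_of_left_lt h3, rfl⟩,
      Set.subset_inter (entourage_mono 𝕜 μ S (min_le_left _ _) (min_le_left _ _))
        (entourage_mono 𝕜 μ S (min_le_right _ _) (min_le_right _ _))⟩

/-- The `(ε, λ)`-uniformity of an RN module, generated by the entourages `U(ε, λ)`. -/
@[reducible]
def epsLambdaUniformSpace [SigmaFinite μ] [NeZero μ] : UniformSpace S :=
  UniformSpace.ofCore (UniformSpace.Core.mkOfBasis (entourageBasis 𝕜 μ S)
    (by
      rintro _ ⟨ε, l, h1, h2, h3, rfl⟩ x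
      simp only [entourage, Set.mem_ofPred_eq, sub_self]
      have h : {ω | rn 𝕜 μ (0 : S) ω < ε} =ᵐ[μ.toFinite] Set.univ := by
        refine (toFinite_absolutelyContinuous μ).ae_eq ?_
        have h0 : rn 𝕜 μ (0 : S) = 0 := (RNModule.rnorm_eq_zero_iff _).2 rfl
        rw [h0]
        filter_upwards [AEEqFun.coeFn_zero (μ := μ) (β := ℝ)] with ω hω
        have : ((0 : Ω →ₘ[μ] ℝ) ω < ε) = True := by rw [hω]; simpa using h1
        exact this
      rw [measureReal_congr h]
      simpa using h2)
    (by
      rintro _ ⟨ε, l, h1, h2, h3, rfl⟩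
      refine ⟨_, ⟨ε, l, h1, h2, h3, rfl⟩, ?_⟩
      rintro ⟨x, y⟩ h
      simp only [entourage, Set.mem_ofPred_eq, Set.mem_preimage, Prod.swap] at *
      rwa [← neg_sub x y, rn_neg])
    (by
      rintro _ ⟨ε, l, h1, h2, h3, rfl⟩
      refine ⟨_, ⟨ε / 2, l / 2, by linarith, by linarith, by linarith, rfl⟩, ?_⟩
      rintro ⟨x, z⟩ ⟨y, hxy, hyz⟩
      exact entourage_comp 𝕜 μ hxy hyz))

/-- `T_{ε,λ}`-completeness: completeness for the `(ε, λ)`-uniformity. -/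
def EpsLambdaComplete [SigmaFinite μ] [NeZero μ] : Prop :=
  @CompleteSpace S (epsLambdaUniformSpace 𝕜 μ S)

/-! ### The normed `L^∞`-module `L^p(S)` generated by an RN module -/

/-- `{x ∈ S : |‖x‖|_p < ∞}` as an additive subgroup of `S`. -/
def lpAddSubgroup (p : ℝ≥0∞) [Fact (1 ≤ p)] : AddSubgroup S where
  carrier := {x | eLpNorm (rn 𝕜 μ x) p μ < ∞}
  zero_mem' := by
    have h0 : rn 𝕜 μ (0 : S) = 0 := (RNModule.rnorm_eq_zero_iff _).2 rfl
    simp only [Set.mem_ofPred_eq, h0]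
    rw [eLpNorm_congr_ae AEEqFun.coeFn_zero]
    simp
  add_mem' := fun {x y} hx hy =>
    (eLpNorm_rn_add_le 𝕜 μ Fact.out x y).trans_lt (ENNReal.add_lt_top.2 ⟨hx, hy⟩)
  neg_mem' := fun {x} hx => by
    simp only [Set.mem_ofPred_eq, rn_neg] at *
    exact hx

/-- The space `L^p(S) = {x ∈ S : |‖x‖|_p < ∞}` generated by the RN module `S`. -/
def LpRN (p : ℝ≥0∞) [Fact (1 ≤ p)] : Type _ := lpAddSubgroup 𝕜 μ S p

variable {S}

/-- The inclusion of `L^p(S)` in `S`. -/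
@[coe]
def LpRN.val {p : ℝ≥0∞} [Fact (1 ≤ p)] (x : LpRN 𝕜 μ S p) : S := Subtype.val x

instance {p : ℝ≥0∞} [Fact (1 ≤ p)] : CoeOut (LpRN 𝕜 μ S p) S := ⟨LpRN.val 𝕜 μ⟩

theorem LpRN.eLpNorm_lt_top {p : ℝ≥0∞} [Fact (1 ≤ p)] (x : LpRN 𝕜 μ S p) :
    eLpNorm (rn 𝕜 μ (x : S)) p μ < ∞ := Subtype.property x

variable (S)

instance instAddCommGroupLpRN (p : ℝ≥0∞) [Fact (1 ≤ p)] : AddCommGroup (LpRN 𝕜 μ S p) :=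
  inferInstanceAs (AddCommGroup (lpAddSubgroup 𝕜 μ S p))

variable {S} in
theorem eLpNorm_rn_smul_lt_top {p : ℝ≥0∞} (ξ : LInfty 𝕜 μ) {x : S}
    (hx : eLpNorm (rn 𝕜 μ x) p μ < ∞) :
    eLpNorm (rn 𝕜 μ (LInfty.toL0 𝕜 μ ξ • x)) p μ < ∞ := by
  have h : rn 𝕜 μ (LInfty.toL0 𝕜 μ ξ • x) = modulus (LInfty.toL0 𝕜 μ ξ) * rn 𝕜 μ x :=
    RNModule.rnorm_smul _ _
  rw [h]
  refine eLpNorm_mul_lt_top ?_ hx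
  rw [eLpNorm_congr_ae (coeFn_modulus _), eLpNorm_norm]
  exact ξ.eLpNorm_toL0_lt_top

/-- `L^p(S)` is a module over `L^∞(F, 𝕜)`, under the multiplication inherited from `S`. -/
instance instModuleLpRN (p : ℝ≥0∞) [Fact (1 ≤ p)] : Module (LInfty 𝕜 μ) (LpRN 𝕜 μ S p) where
  smul ξ x := ⟨LInfty.toL0 𝕜 μ ξ • (x : S), eLpNorm_rn_smul_lt_top 𝕜 μ ξ x.eLpNorm_lt_top⟩
  one_smul x := Subtype.ext (by
    show LInfty.toL0 𝕜 μ 1 • (x : S) = x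
    rw [map_one, one_smul])
  mul_smul ξ η x := Subtype.ext (by
    show LInfty.toL0 𝕜 μ (ξ * η) • (x : S) = LInfty.toL0 𝕜 μ ξ • LInfty.toL0 𝕜 μ η • (x : S)
    rw [map_mul, mul_smul])
  smul_zero ξ := Subtype.ext (smul_zero (LInfty.toL0 𝕜 μ ξ))
  smul_add ξ x y := Subtype.ext (smul_add (LInfty.toL0 𝕜 μ ξ) (x : S) (y : S))
  add_smul ξ η x := Subtype.ext (by
    show LInfty.toL0 𝕜 μ (ξ + η) • (x : S) =
      LInfty.toL0 𝕜 μ ξ • (x : S) + LInfty.toL0 𝕜 μ η • (x : S)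
    rw [map_add, add_smul])
  zero_smul x := Subtype.ext (by
    show LInfty.toL0 𝕜 μ 0 • (x : S) = 0
    rw [map_zero, zero_smul])

/-- The norm `|||x|||_p = |‖x‖|_p` on `L^p(S)`. -/
instance instNormedAddCommGroupLpRN (p : ℝ≥0∞) [hp : Fact (1 ≤ p)] :
    NormedAddCommGroup (LpRN 𝕜 μ S p) :=
  AddGroupNorm.toNormedAddCommGroup
    { toFun := fun x => (eLpNorm (rn 𝕜 μ (x : S)) p μ).toReal
      map_zero' := by
        have h0 : rn 𝕜 μ ((0 : LpRN 𝕜 μ S p) : S) = 0 := (RNModule.rnorm_eq_zero_iff _).2 rfl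
        rw [h0, eLpNorm_congr_ae AEEqFun.coeFn_zero]
        simp
      add_le' := fun x y => by
        have hx := x.eLpNorm_lt_top.ne
        have hy := y.eLpNorm_lt_top.ne
        rw [← ENNReal.toReal_add hx hy]
        exact ENNReal.toReal_mono (ENNReal.add_ne_top.2 ⟨hx, hy⟩)
          (eLpNorm_rn_add_le 𝕜 μ hp.out (x : S) (y : S))
      neg' := fun x => by
        have h : rn 𝕜 μ ((-x : LpRN 𝕜 μ S p) : S) = rn 𝕜 μ (x : S) := rn_neg 𝕜 μ (x : S)
        rw [h]
      eq_zero_of_map_eq_zero' := fun x hx => by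
        have hx' : eLpNorm (rn 𝕜 μ (x : S)) p μ = 0 :=
          ((ENNReal.toReal_eq_zero_iff _).1 hx).resolve_right x.eLpNorm_lt_top.ne
        rw [eLpNorm_eq_zero_iff (rn 𝕜 μ (x : S)).aestronglyMeasurable
          (zero_lt_one.trans_le hp.out).ne'] at hx'
        have h0 : rn 𝕜 μ (x : S) = 0 := AEEqFun.ext (hx'.trans AEEqFun.coeFn_zero.symm)
        exact Subtype.ext ((RNModule.rnorm_eq_zero_iff _).1 h0) }

end RN

/-! ### Module duals -/

/-- The module dual `M*_m = Hom(M, L¹(F, 𝕜))` of a normed module `M` over `L^∞(F, 𝕜)`: the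
continuous `L^∞(F, 𝕜)`-linear maps (these are automatically `𝕜`-linear, `𝕜` being embedded in
`L^∞(F, 𝕜)` as the constants). -/
abbrev ModuleDual (𝕜 : Type*) [RCLike 𝕜] {Ω : Type*} [MeasurableSpace Ω] (μ : Measure Ω)
    (M : Type*) [NormedAddCommGroup M] [Module (LInfty 𝕜 μ) M] : Type _ :=
  M →L[LInfty 𝕜 μ] Lp 𝕜 1 μ

/-- The norm `|||f||| = sup {∫ |f(x)| dμ : x ∈ M, |||x||| ≤ 1}` of an element of the module dual
(valued in `[0, ∞]`). -/
def moduleDualNorm {M : Type*} [NormedAddCommGroup M] [Module (LInfty 𝕜 μ) M]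
    (f : ModuleDual 𝕜 μ M) : ℝ≥0∞ :=
  ⨆ x : {x : M // ‖x‖ ≤ 1}, ∫⁻ ω, ‖f x.1 ω‖ₑ ∂μ

/-! ### The random conjugate space -/

section Conj

variable (𝕜 μ) (S : Type*) [AddCommGroup S] [Module 𝕜 S] [Module (Ω →ₘ[μ] 𝕜) S]
  [IsScalarTower 𝕜 (Ω →ₘ[μ] 𝕜) S] [RNModule 𝕜 μ S]

variable {S} in
/-- The set of all `ξ ∈ L⁰₊(F)` such that `|F(x)| ≤ ξ ‖x‖` for every `x ∈ S`. -/
def randomBounds (F : S →ₗ[𝕜] (Ω →ₘ[μ] 𝕜)) : Set (Ω →ₘ[μ] ℝ) :=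
  {ξ | 0 ≤ ξ ∧ ∀ x, modulus (F x) ≤ ξ * rn 𝕜 μ x}

variable {S} in
theorem mem_randomBounds_iff {F : S →ₗ[𝕜] (Ω →ₘ[μ] 𝕜)} {ξ : Ω →ₘ[μ] ℝ} :
    ξ ∈ randomBounds 𝕜 μ F ↔
      (∀ᵐ ω ∂μ, 0 ≤ ξ ω) ∧ ∀ x, ∀ᵐ ω ∂μ, ‖F x ω‖ ≤ ξ ω * rn 𝕜 μ x ω := by
  refine and_congr ?_ (forall_congr' fun x => ?_)
  · rw [← AEEqFun.coeFn_le]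
    refine eventually_congr ?_
    filter_upwards [AEEqFun.coeFn_zero (μ := μ) (β := ℝ)] with ω h
    rw [h]; rfl
  · rw [← AEEqFun.coeFn_le]
    refine eventually_congr ?_
    filter_upwards [coeFn_modulus (F x), coeFn_mul' ξ (rn 𝕜 μ x)] with ω h1 h2
    rw [h1, h2]

/-- The random conjugate space `S*` of all a.e. bounded random linear functionals, i.e. `𝕜`-linear
`F : S → L⁰(F, 𝕜)` with `|F(x)| ≤ ξ ‖x‖` for all `x`, for some `ξ ∈ L⁰₊(F)`. It is an
`L⁰(F, 𝕜)`-module under `(ξ F)(x) = ξ · F(x)`. -/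
def RandomConj : Submodule (Ω →ₘ[μ] 𝕜) (S →ₗ[𝕜] (Ω →ₘ[μ] 𝕜)) where
  carrier := {F | (randomBounds 𝕜 μ F).Nonempty}
  zero_mem' := by
    refine ⟨0, (mem_randomBounds_iff 𝕜 μ).2 ⟨?_, fun x => ?_⟩⟩
    · filter_upwards [AEEqFun.coeFn_zero (μ := μ) (β := ℝ)] with ω h
      rw [h]; rfl
    · filter_upwards [AEEqFun.coeFn_zero (μ := μ) (β := ℝ),
        AEEqFun.coeFn_zero (μ := μ) (β := 𝕜)] with ω h h'
      simp [h, h']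
  add_mem' := by
    rintro F G ⟨ξ, hξ⟩ ⟨η, hη⟩
    rw [mem_randomBounds_iff] at hξ hη
    refine ⟨ξ + η, (mem_randomBounds_iff 𝕜 μ).2 ⟨?_, fun x => ?_⟩⟩
    · filter_upwards [hξ.1, hη.1, AEEqFun.coeFn_add ξ η] with ω h1 h2 h3
      rw [h3]; exact add_nonneg h1 h2
    · filter_upwards [hξ.2 x, hη.2 x, AEEqFun.coeFn_add ξ η, AEEqFun.coeFn_add (F x) (G x)]
        with ω h1 h2 h3 h4
      rw [LinearMap.add_apply, h3, h4, Pi.add_apply, Pi.add_apply, add_mul]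
      exact (norm_add_le _ _).trans (add_le_add h1 h2)
  smul_mem' := by
    rintro ζ F ⟨ξ, hξ⟩
    rw [mem_randomBounds_iff] at hξ
    refine ⟨modulus ζ * ξ, (mem_randomBounds_iff 𝕜 μ).2 ⟨?_, fun x => ?_⟩⟩
    · filter_upwards [hξ.1, coeFn_modulus ζ, coeFn_mul' (modulus ζ) ξ] with ω h1 h2 h3
      rw [h3, h2]; exact mul_nonneg (norm_nonneg _) h1
    · filter_upwards [hξ.2 x, coeFn_modulus ζ, coeFn_mul' (modulus ζ) ξ, coeFn_mul' ζ (F x)]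
        with ω h1 h2 h3 h4
      rw [LinearMap.smul_apply, smul_eq_mul, h4, h3, h2, norm_mul, mul_assoc]
      exact mul_le_mul_of_nonneg_left h1 (norm_nonneg _)

variable {S}

/-- The infimum in the definition of the `L⁰`-norm of `F ∈ S*` exists and is attained. -/
theorem exists_isLeast_randomBounds [SigmaFinite μ] (F : RandomConj 𝕜 μ S) :
    ∃ η, IsLeast (randomBounds 𝕜 μ (F : S →ₗ[𝕜] (Ω →ₘ[μ] 𝕜))) η := by
  set B := randomBounds 𝕜 μ (F : S →ₗ[𝕜] (Ω →ₘ[μ] 𝕜)) with hB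
  have hne : B.Nonempty := F.2
  let φ : (Ω →ₘ[μ] ℝ) → ℝ := fun ξ => ∫ ω, Real.arctan (ξ ω) ∂μ.toFinite
  have hint : ∀ ξ : Ω →ₘ[μ] ℝ, Integrable (fun ω => Real.arctan (ξ ω)) μ.toFinite := fun ξ => by
    refine Integrable.of_bound (C := Real.pi / 2)
      (Real.measurable_arctan.comp ξ.measurable).aestronglyMeasurable
      (Eventually.of_forall fun ω => ?_)
    rw [Real.norm_eq_abs, abs_le]
    exact ⟨by linarith [Real.neg_pi_div_two_lt_arctan (ξ ω)], (Real.arctan_lt_pi_div_two _).le⟩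
  have hmono : ∀ ξ η : Ω →ₘ[μ] ℝ, (∀ᵐ ω ∂μ, ξ ω ≤ η ω) → φ ξ ≤ φ η := fun ξ η h =>
    integral_mono_ae (hint ξ) (hint η) ((toFinite_absolutelyContinuous μ).ae_le
      (h.mono fun ω hω => Real.arctan_strictMono.monotone hω))
  have hbdd : BddBelow (φ '' B) := by
    refine ⟨0, ?_⟩
    rintro _ ⟨ξ, hξ, rfl⟩
    refine integral_nonneg_of_ae ((toFinite_absolutelyContinuous μ).ae_le ?_)
    filter_upwards [((mem_randomBounds_iff 𝕜 μ).1 hξ).1] with ω h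
    exact Real.arctan_nonneg.2 h
  obtain ⟨u, -, hu, huB⟩ := exists_seq_tendsto_sInf (hne.image φ) hbdd
  choose ξ hξB hξ using huB
  have hξ0 : ∀ᵐ ω ∂μ, ∀ n, 0 ≤ ξ n ω :=
    ae_all_iff.2 fun n => ((mem_randomBounds_iff 𝕜 μ).1 (hξB n)).1
  have hmeas : Measurable fun ω => ⨅ n, ξ n ω := Measurable.iInf fun n => (ξ n).measurable
  let η : Ω →ₘ[μ] ℝ := AEEqFun.mk (fun ω => ⨅ n, ξ n ω) hmeas.aestronglyMeasurable
  have hη : ∀ᵐ ω ∂μ, η ω = ⨅ n, ξ n ω := AEEqFun.coeFn_mk _ _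
  have hηB : η ∈ B := by
    refine (mem_randomBounds_iff 𝕜 μ).2 ⟨?_, fun x => ?_⟩
    · filter_upwards [hη, hξ0] with ω h1 h2
      rw [h1]; exact le_ciInf h2
    · filter_upwards [hη, hξ0, coeFn_rn_nonneg 𝕜 μ x,
        ae_all_iff.2 fun n => ((mem_randomBounds_iff 𝕜 μ).1 (hξB n)).2 x] with ω h1 h2 h3 h4
      rw [h1, Real.iInf_mul_of_nonneg h3]
      exact le_ciInf h4
  refine ⟨η, hηB, fun ζ hζ => ?_⟩
  let κ : Ω →ₘ[μ] ℝ := η ⊓ ζ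
  have hκ : ∀ᵐ ω ∂μ, κ ω = min (η ω) (ζ ω) := AEEqFun.coeFn_inf η ζ
  have hκB : κ ∈ B := by
    refine (mem_randomBounds_iff 𝕜 μ).2 ⟨?_, fun x => ?_⟩
    · filter_upwards [hκ, ((mem_randomBounds_iff 𝕜 μ).1 hηB).1,
        ((mem_randomBounds_iff 𝕜 μ).1 hζ).1] with ω h1 h2 h3
      rw [h1]; exact le_min h2 h3
    · filter_upwards [hκ, ((mem_randomBounds_iff 𝕜 μ).1 hηB).2 x,
        ((mem_randomBounds_iff 𝕜 μ).1 hζ).2 x] with ω h1 h2 h3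
      rw [h1]
      rcases min_choice (η ω) (ζ ω) with h | h <;> rw [h] <;> assumption
  have h1 : φ η ≤ sInf (φ '' B) := by
    refine ge_of_tendsto' hu fun n => ?_
    rw [← hξ n]
    refine hmono _ _ ?_
    filter_upwards [hη, hξ0] with ω h1 h2
    rw [h1]
    exact ciInf_le ⟨0, by rintro _ ⟨m, rfl⟩; exact h2 m⟩ n
  have h2 : sInf (φ '' B) ≤ φ κ := csInf_le hbdd ⟨κ, hκB, rfl⟩
  have hle : ∀ᵐ ω ∂μ, κ ω ≤ η ω := hκ.mono fun ω h => h ▸ min_le_left _ _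
  have heq : φ κ = φ η := le_antisymm (hmono _ _ hle) (h1.trans h2)
  have hae : (fun ω => Real.arctan (κ ω)) =ᵐ[μ.toFinite] fun ω => Real.arctan (η ω) :=
    (integral_eq_iff_of_ae_le (hint κ) (hint η) ((toFinite_absolutelyContinuous μ).ae_le
      (hle.mono fun ω hω => Real.arctan_strictMono.monotone hω))).1 heq
  refine AEEqFun.coeFn_le.1 ?_
  filter_upwards [(absolutelyContinuous_toFinite μ).ae_le hae, hκ] with ω h3 h4
  have h5 : κ ω = η ω := Real.arctan_injective h3
  rw [← h5, h4]
  exact min_le_right _ _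

theorem exists_isGLB_randomBounds [SigmaFinite μ] (F : RandomConj 𝕜 μ S) :
    ∃ η, IsGLB (randomBounds 𝕜 μ (F : S →ₗ[𝕜] (Ω →ₘ[μ] 𝕜))) η :=
  (exists_isLeast_randomBounds 𝕜 μ F).imp fun _ h => h.isGLB

/-- The `L⁰`-norm `‖F‖ = ⋀ {ξ ∈ L⁰₊(F) : |F(x)| ≤ ξ ‖x‖ for all x ∈ S}` on `S*`, the infimum being
taken in the lattice `L⁰(F)`. -/
def conjNorm [SigmaFinite μ] (F : RandomConj 𝕜 μ S) : Ω →ₘ[μ] ℝ :=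
  (exists_isGLB_randomBounds 𝕜 μ F).choose

theorem isGLB_conjNorm [SigmaFinite μ] (F : RandomConj 𝕜 μ S) :
    IsGLB (randomBounds 𝕜 μ (F : S →ₗ[𝕜] (Ω →ₘ[μ] 𝕜))) (conjNorm 𝕜 μ F) :=
  (exists_isGLB_randomBounds 𝕜 μ F).choose_spec

theorem conjNorm_mem [SigmaFinite μ] (F : RandomConj 𝕜 μ S) :
    conjNorm 𝕜 μ F ∈ randomBounds 𝕜 μ (F : S →ₗ[𝕜] (Ω →ₘ[μ] 𝕜)) := by
  obtain ⟨η, hη⟩ := exists_isLeast_randomBounds 𝕜 μ F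
  rw [(isGLB_conjNorm 𝕜 μ F).unique hη.isGLB]
  exact hη.1

/-- The random conjugate space is an RN module. -/
instance instRNModuleRandomConj [SigmaFinite μ] : RNModule 𝕜 μ (RandomConj 𝕜 μ S) where
  rnorm := conjNorm 𝕜 μ
  rnorm_nonneg F := (conjNorm_mem 𝕜 μ F).1
  rnorm_eq_zero_iff F := by
    constructor
    · intro h
      have h2 := ((mem_randomBounds_iff 𝕜 μ).1 (conjNorm_mem 𝕜 μ F)).2
      apply Subtype.ext
      ext1 x
      apply AEEqFun.ext
      filter_upwards [h2 x, AEEqFun.coeFn_zero (μ := μ) (β := ℝ),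
        AEEqFun.coeFn_zero (μ := μ) (β := 𝕜)] with ω h3 h4 h5
      rw [h, h4, Pi.zero_apply, zero_mul] at h3
      have h6 : (F : S →ₗ[𝕜] (Ω →ₘ[μ] 𝕜)) x ω = 0 := by simpa using h3
      rw [h6]
      simp [h5]
    · rintro rfl
      refine le_antisymm ((isGLB_conjNorm 𝕜 μ _).1 ?_) (conjNorm_mem 𝕜 μ _).1
      refine (mem_randomBounds_iff 𝕜 μ).2 ⟨?_, fun x => ?_⟩
      · filter_upwards [AEEqFun.coeFn_zero (μ := μ) (β := ℝ)] with ω h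
        rw [h]; rfl
      · filter_upwards [AEEqFun.coeFn_zero (μ := μ) (β := ℝ),
          AEEqFun.coeFn_zero (μ := μ) (β := 𝕜)] with ω h h'
        simp [h, h']
  rnorm_smul ζ F := by
    obtain ⟨hF1, hF2⟩ := (mem_randomBounds_iff 𝕜 μ).1 (conjNorm_mem 𝕜 μ F)
    obtain ⟨hG1, hG2⟩ := (mem_randomBounds_iff 𝕜 μ).1 (conjNorm_mem 𝕜 μ (ζ • F))
    apply le_antisymm
    · refine (isGLB_conjNorm 𝕜 μ _).1 ((mem_randomBounds_iff 𝕜 μ).2 ⟨?_, fun x => ?_⟩)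
      · filter_upwards [hF1, coeFn_modulus ζ, coeFn_mul' (modulus ζ) (conjNorm 𝕜 μ F)]
          with ω h1 h2 h3
        rw [h3, h2]; exact mul_nonneg (norm_nonneg _) h1
      · filter_upwards [hF2 x, coeFn_modulus ζ, coeFn_mul' (modulus ζ) (conjNorm 𝕜 μ F),
          coeFn_mul' ζ ((F : S →ₗ[𝕜] (Ω →ₘ[μ] 𝕜)) x)] with ω h1 h2 h3 h4
        rw [Submodule.coe_smul, LinearMap.smul_apply, smul_eq_mul, h4, h3, h2, norm_mul, mul_assoc]
        exact mul_le_mul_of_nonneg_left h1 (norm_nonneg _)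
    · classical
      let A : Set Ω := {ω | ζ ω = 0}
      have hA : MeasurableSet A := ζ.measurable (measurableSet_singleton 0)
      let k : Ω → ℝ := A.piecewise (conjNorm 𝕜 μ F) fun ω => conjNorm 𝕜 μ (ζ • F) ω / ‖ζ ω‖
      have hk : Measurable k := Measurable.piecewise hA (conjNorm 𝕜 μ F).measurable
        ((conjNorm 𝕜 μ (ζ • F)).measurable.div ζ.measurable.norm)
      let κ : Ω →ₘ[μ] ℝ := AEEqFun.mk k hk.aestronglyMeasurable
      have hκ : ∀ᵐ ω ∂μ, κ ω = k ω := AEEqFun.coeFn_mk _ _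
      have hκB : κ ∈ randomBounds 𝕜 μ (F : S →ₗ[𝕜] (Ω →ₘ[μ] 𝕜)) := by
        refine (mem_randomBounds_iff 𝕜 μ).2 ⟨?_, fun x => ?_⟩
        · filter_upwards [hκ, hF1, hG1] with ω h1 h2 h3
          rw [h1]
          by_cases h : ω ∈ A
          · simpa [k, h] using h2
          · simpa [k, h] using div_nonneg h3 (norm_nonneg _)
        · filter_upwards [hκ, hF2 x, hG2 x,
            coeFn_mul' ζ ((F : S →ₗ[𝕜] (Ω →ₘ[μ] 𝕜)) x)] with ω h1 h2 h3 h4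
          rw [h1]
          by_cases h : ω ∈ A
          · simpa [k, h] using h2
          · have h0 : 0 < ‖ζ ω‖ := norm_pos_iff.2 h
            rw [Submodule.coe_smul, LinearMap.smul_apply, smul_eq_mul, h4, norm_mul] at h3
            simp only [k, h, not_false_eq_true, Set.piecewise_eq_of_notMem]
            rw [div_mul_eq_mul_div, le_div_iff₀ h0, mul_comm]
            exact h3
      have hle := AEEqFun.coeFn_le.2 ((isGLB_conjNorm 𝕜 μ F).1 hκB)
      refine AEEqFun.coeFn_le.1 ?_
      filter_upwards [hle, hκ, hG1, coeFn_modulus ζ,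
        coeFn_mul' (modulus ζ) (conjNorm 𝕜 μ F)] with ω h1 h2 h3 h4 h5
      rw [h5, h4]
      by_cases h : ω ∈ A
      · have h0 : ζ ω = 0 := h
        rw [h0, norm_zero, zero_mul]
        exact h3
      · have h0 : 0 < ‖ζ ω‖ := norm_pos_iff.2 h
        rw [h2] at h1
        simp only [k, h, not_false_eq_true, Set.piecewise_eq_of_notMem] at h1
        rwa [le_div_iff₀ h0, mul_comm] at h1
  rnorm_add_le F G := by
    obtain ⟨hF1, hF2⟩ := (mem_randomBounds_iff 𝕜 μ).1 (conjNorm_mem 𝕜 μ F)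
    obtain ⟨hG1, hG2⟩ := (mem_randomBounds_iff 𝕜 μ).1 (conjNorm_mem 𝕜 μ G)
    refine (isGLB_conjNorm 𝕜 μ _).1 ((mem_randomBounds_iff 𝕜 μ).2 ⟨?_, fun x => ?_⟩)
    · filter_upwards [hF1, hG1, AEEqFun.coeFn_add (conjNorm 𝕜 μ F) (conjNorm 𝕜 μ G)]
        with ω h1 h2 h3
      rw [h3]; exact add_nonneg h1 h2
    · filter_upwards [hF2 x, hG2 x, AEEqFun.coeFn_add (conjNorm 𝕜 μ F) (conjNorm 𝕜 μ G),
        AEEqFun.coeFn_add ((F : S →ₗ[𝕜] (Ω →ₘ[μ] 𝕜)) x) ((G : S →ₗ[𝕜] (Ω →ₘ[μ] 𝕜)) x)]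
        with ω h1 h2 h3 h4
      rw [Submodule.coe_add, LinearMap.add_apply, h3, h4, Pi.add_apply, Pi.add_apply, add_mul]
      exact (norm_add_le _ _).trans (add_le_add h1 h2)

end Conj

end

end RandomNormed

open MeasureTheory RandomNormed
open scoped ENNReal

namespace RandomNormed

open Filter Topology

/-! ### Pointwise a.e. estimates and densities of dominated set functions -/

section Analysis

variable {Ω : Type*} [MeasurableSpace Ω] {μ : Measure Ω}

/-! The pairing is local: `f` commutes with bounded multipliers, so the norm of `f` is the
`L^q`-norm of a random weight, and an extension that keeps the weight keeps the norm.

The weight `ξ` is the essential supremum of `|f(x)|` over those `x` in `M` with `‖x‖ ≤ 1` a.e.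
Gluing two such `x` along a measurable set shows that the family is upward directed, so `ξ` is an
a.e. monotone limit of members (`exists_seq_ae_le_iSup`). For bounded `η ≥ 0` in `L^p`, `∫ η |f(x)|
= ∫ |f(η x)| ≤ |||f||| |η|_p`. Passing to the limit and using the converse of Hölder's inequality
(`eLpNorm_le_of_forall_lintegral_mul_le`), `|ξ|_q ≤ |||f|||`. Normalising an arbitrary `x` gives
`|f(x)| ≤ ξ ‖x‖` (`exists_dominating_weight`).

The extension is a random Hahn–Banach theorem (`exists_extension_of_norm_le`), reduced to the scalar
one by integration. The functional `x ↦ ∫ f(x)` is dominated by the seminorm `∫ ξ ‖x‖` and extends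
to some `ψ` on the space where that seminorm is finite. For each `x`, `A ↦ ψ(1_A x)` is a measure
dominated by `ξ ‖x‖ μ`. Its Radon–Nikodym density `Φ(x)` satisfies `|Φ(x)| ≤ ξ ‖x‖`, and it agrees
with `f(x)` on `M` because `f` commutes with indicators. Every element of `S` becomes integrable
against `ξ` after multiplication by an invertible element of `L⁰`, so `Φ` extends to all of `S`.
Hölder's inequality and restriction then close a cycle of inequalities between the three norms. -/

theorem ae_forall_of_isClosed {X : Type*} [TopologicalSpace X] [TopologicalSpace.SeparableSpace X]
    {P : X → Ω → Prop} (hP : ∀ ω, IsClosed {x | P x ω}) (h : ∀ x, ∀ᵐ ω ∂μ, P x ω) :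
    ∀ᵐ ω ∂μ, ∀ x, P x ω := by
  obtain ⟨s, hsc, hsd⟩ := TopologicalSpace.exists_countable_dense X
  have h1 : ∀ᵐ ω ∂μ, ∀ x ∈ s, P x ω := (ae_ball_iff hsc).2 fun x _ => h x
  filter_upwards [h1] with ω hω x
  have : closure s ⊆ {x | P x ω} := closure_minimal hω (hP ω)
  exact this (hsd x)

/-- Pointwise one would test with `c` the conjugate of `f ω`, which depends on `ω`. Separability of
`𝕜` and closedness of the condition in `c` allow one null set to serve all `c`. The constants `1`
and `-1` give `0 ≤ t`, which settles the points where `f` vanishes. -/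
theorem ae_norm_le_of_forall_re_mul_le {𝕜 : Type*} [RCLike 𝕜] {f : Ω → 𝕜} {t : Ω → ℝ}
    (h : ∀ c : 𝕜, ∀ᵐ ω ∂μ, RCLike.re (c * f ω) ≤ ‖c‖ * t ω) : ∀ᵐ ω ∂μ, ‖f ω‖ ≤ t ω := by
  have h1 : ∀ᵐ ω ∂μ, 0 ≤ t ω := by
    filter_upwards [h 1, h (-1)] with ω h1 h2
    simp at h1 h2
    linarith
  have h2 := ae_forall_of_isClosed (P := fun c ω => RCLike.re (c * f ω) ≤ ‖c‖ * t ω)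
    (fun ω => isClosed_le (RCLike.continuous_re.comp (by fun_prop)) (by fun_prop)) h
  filter_upwards [h1, h2] with ω h0 hω
  rcases (norm_nonneg (f ω)).eq_or_lt with h3 | h3
  · rwa [← h3]
  · have h4 := hω (starRingEnd 𝕜 (f ω))
    rw [RCLike.conj_mul, RCLike.norm_conj] at h4
    have h5 : RCLike.re ((‖f ω‖ : 𝕜) ^ 2) = ‖f ω‖ * ‖f ω‖ := by
      rw [← RCLike.ofReal_pow, RCLike.ofReal_re, sq]
    rw [h5] at h4
    exact le_of_mul_le_mul_left h4 h3

/-- A real additive set function dominated by a finite measure absolutely continuous with respect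
to `μ` has a density with respect to `μ`. -/
theorem exists_density_real [SigmaFinite μ] {ν : Measure Ω} [IsFiniteMeasure ν] (hν : ν ≪ μ)
    (m : Set Ω → ℝ) (hm : ∀ s, MeasurableSet s → ‖m s‖ₑ ≤ ν s)
    (hadd : ∀ s t, MeasurableSet s → MeasurableSet t → Disjoint s t → m (s ∪ t) = m s + m t) :
    ∃ g : Ω → ℝ, Integrable g μ ∧ ∀ s, MeasurableSet s → ∫ ω in s, g ω ∂μ = m s := by
  classical
  -- Domination by the finite measure `ν` upgrades finite additivity to countable additivity. A
  -- vector measure has to vanish on nonmeasurable sets, hence the default `0`.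
  let v : SignedMeasure Ω := VectorMeasure.of_additive_of_le_measure (μ := ν)
    (fun s => if MeasurableSet s then m s else 0)
    (fun s => by
      by_cases hs : MeasurableSet s
      · simpa [hs] using hm s hs
      · simp [hs])
    (fun s t hs ht hst => by simp [hs, ht, hs.union ht, hadd s t hs ht hst])
    (fun s hs => by simp [hs])
  have hv : ∀ s, MeasurableSet s → v s = m s := fun s hs => if_pos hs
  have hac : v ≪ᵥ μ.toENNRealVectorMeasure := by
    refine VectorMeasure.AbsolutelyContinuous.mk fun s hs h0 => ?_
    rw [Measure.toENNRealVectorMeasure_apply_measurable hs] at h0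
    have h1 := hm s hs
    rw [hν h0] at h1
    rw [hv s hs]
    simpa using h1
  refine ⟨v.rnDeriv μ, SignedMeasure.integrable_rnDeriv _ _, fun s hs => ?_⟩
  rw [← withDensityᵥ_apply (SignedMeasure.integrable_rnDeriv _ _) hs,
    SignedMeasure.withDensityᵥ_rnDeriv_eq v μ hac, hv s hs]

/-- An additive set function dominated by a finite measure absolutely continuous with respect
to `μ` has a density with respect to `μ`. -/
theorem exists_density {𝕜 : Type*} [RCLike 𝕜] [SigmaFinite μ] {ν : Measure Ω} [IsFiniteMeasure ν]
    (hν : ν ≪ μ) (m : Set Ω → 𝕜) (hm : ∀ s, MeasurableSet s → ‖m s‖ₑ ≤ ν s)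
    (hadd : ∀ s t, MeasurableSet s → MeasurableSet t → Disjoint s t → m (s ∪ t) = m s + m t) :
    ∃ g : Ω → 𝕜, Integrable g μ ∧ ∀ s, MeasurableSet s → ∫ ω in s, g ω ∂μ = m s := by
  obtain ⟨a, ha, ham⟩ := exists_density_real hν (fun s => RCLike.re (m s))
    (fun s hs => le_trans (by
      rw [enorm_le_iff_norm_le]
      exact RCLike.norm_re_le_norm _) (hm s hs))
    (fun s t hs ht hst => by rw [hadd s t hs ht hst, map_add])
  obtain ⟨b, hb, hbm⟩ := exists_density_real hν (fun s => RCLike.im (m s))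
    (fun s hs => le_trans (by
      rw [enorm_le_iff_norm_le]
      exact RCLike.norm_im_le_norm _) (hm s hs))
    (fun s t hs ht hst => by rw [hadd s t hs ht hst, map_add])
  have hi : Integrable (fun ω => (a ω : 𝕜) + (b ω : 𝕜) * RCLike.I) μ :=
    ha.ofReal.add (hb.ofReal.mul_const _)
  refine ⟨_, hi, fun s hs => ?_⟩
  have has : Integrable a (μ.restrict s) := ha.integrableOn
  have hbs : Integrable b (μ.restrict s) := hb.integrableOn
  rw [integral_add has.ofReal (hbs.ofReal.mul_const _), integral_mul_const, integral_ofReal, integral_ofReal, ham s hs, hbm s hs, RCLike.re_add_im]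

end Analysis

/-! ### Indicators and pointwise identities for the random norm -/

section RN

variable {𝕜 : Type*} [RCLike 𝕜] {Ω : Type*} [MeasurableSpace Ω] {μ : Measure Ω}

variable (𝕜 μ) in
/-- The class of the indicator function of a measurable set. -/
noncomputable def ind {A : Set Ω} (hA : MeasurableSet A) : Ω →ₘ[μ] 𝕜 :=
  AEEqFun.mk (A.indicator fun _ => (1 : 𝕜)) (measurable_const.indicator hA).aestronglyMeasurable

theorem coeFn_ind {A : Set Ω} (hA : MeasurableSet A) :
    ∀ᵐ ω ∂μ, ind 𝕜 μ hA ω = A.indicator (fun _ => (1 : 𝕜)) ω :=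
  AEEqFun.coeFn_mk _ _

theorem ind_union {A B : Set Ω} (hA : MeasurableSet A) (hB : MeasurableSet B)
    (h : Disjoint A B) : ind 𝕜 μ (hA.union hB) = ind 𝕜 μ hA + ind 𝕜 μ hB := by
  apply AEEqFun.ext
  filter_upwards [coeFn_ind (𝕜 := 𝕜) (μ := μ) hA, coeFn_ind (𝕜 := 𝕜) (μ := μ) hB,
    coeFn_ind (𝕜 := 𝕜) (μ := μ) (hA.union hB),
    AEEqFun.coeFn_add (ind 𝕜 μ hA) (ind 𝕜 μ hB)] with ω h1 h2 h3 h4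
  rw [h3, h4, Pi.add_apply, h1, h2, Set.indicator_union_of_disjoint h]

theorem setIntegral_eq_integral_ind_mul {A : Set Ω} (hA : MeasurableSet A) (g : Ω →ₘ[μ] 𝕜) :
    ∫ ω in A, g ω ∂μ = ∫ ω, (ind 𝕜 μ hA * g) ω ∂μ := by
  rw [← integral_indicator hA]
  refine integral_congr_ae ?_
  filter_upwards [coeFn_ind (𝕜 := 𝕜) (μ := μ) hA, coeFn_mul' (ind 𝕜 μ hA) g] with ω h1 h2
  rw [h2, h1]
  by_cases h : ω ∈ A <;> simp [h]

variable {S : Type*} [AddCommGroup S] [Module 𝕜 S] [Module (Ω →ₘ[μ] 𝕜) S]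
  [IsScalarTower 𝕜 (Ω →ₘ[μ] 𝕜) S] [RNModule 𝕜 μ S]

theorem coeFn_rn_smul (η : Ω →ₘ[μ] 𝕜) (x : S) :
    ∀ᵐ ω ∂μ, rn 𝕜 μ (η • x) ω = ‖η ω‖ * rn 𝕜 μ x ω := by
  have h : rn 𝕜 μ (η • x) = modulus η * rn 𝕜 μ x := RNModule.rnorm_smul _ _
  rw [h]
  filter_upwards [coeFn_modulus η, coeFn_mul' (modulus η) (rn 𝕜 μ x)] with ω h1 h2
  rw [h2, h1]

theorem coeFn_algebraMap (c : 𝕜) : ∀ᵐ ω ∂μ, algebraMap 𝕜 (Ω →ₘ[μ] 𝕜) c ω = c := by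
  rw [Algebra.algebraMap_eq_smul_one]
  filter_upwards [AEEqFun.coeFn_smul c (1 : Ω →ₘ[μ] 𝕜), AEEqFun.coeFn_one (μ := μ) (β := 𝕜)]
    with ω h1 h2
  rw [h1, Pi.smul_apply, h2]
  simp

theorem coeFn_rn_const_smul (c : 𝕜) (x : S) :
    ∀ᵐ ω ∂μ, rn 𝕜 μ (c • x) ω = ‖c‖ * rn 𝕜 μ x ω := by
  rw [← algebraMap_smul (Ω →ₘ[μ] 𝕜) c x]
  filter_upwards [coeFn_rn_smul (algebraMap 𝕜 (Ω →ₘ[μ] 𝕜) c) x,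
    coeFn_algebraMap (μ := μ) c] with ω h1 h2
  rw [h1, h2]

theorem coeFn_rn_zero : ∀ᵐ ω ∂μ, rn 𝕜 μ (0 : S) ω = 0 := by
  have h0 : rn 𝕜 μ (0 : S) = 0 := (RNModule.rnorm_eq_zero_iff _).2 rfl
  rw [h0]
  exact AEEqFun.coeFn_zero

/-! ### Scalarisation by a weight and the random Hahn–Banach theorem -/

variable (𝕜 μ S) in
/-- The elements of `S` whose `L⁰`-norm is integrable against the weight `ξ`. -/
def weightedL1 {ξ : Ω → ℝ} (hξ : Measurable ξ) (hξ0 : ∀ ω, 0 ≤ ξ ω) : Submodule 𝕜 S where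
  carrier := {x | Integrable (fun ω => ξ ω * rn 𝕜 μ x ω) μ}
  zero_mem' := by
    refine (integrable_zero Ω ℝ μ).congr ?_
    filter_upwards [coeFn_rn_zero (𝕜 := 𝕜) (μ := μ) (S := S)] with ω h
    rw [h, mul_zero, Pi.zero_apply]
  add_mem' {x y} hx hy := by
    refine (hx.add hy).mono' (hξ.mul (rn 𝕜 μ (x + y)).measurable).aestronglyMeasurable ?_
    filter_upwards [coeFn_rn_add_le 𝕜 μ x y, coeFn_rn_nonneg 𝕜 μ (x + y)] with ω h1 h2
    rw [Real.norm_of_nonneg (mul_nonneg (hξ0 ω) h2), Pi.add_apply, ← mul_add]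
    exact mul_le_mul_of_nonneg_left h1 (hξ0 ω)
  smul_mem' c x hx := by
    refine (hx.const_mul ‖c‖).congr ?_
    filter_upwards [coeFn_rn_const_smul (μ := μ) c x] with ω h
    rw [h]; ring

section Weighted

variable {ξ : Ω → ℝ} (hξ : Measurable ξ) (hξ0 : ∀ ω, 0 ≤ ξ ω)

theorem smul_mem_weightedL1 {x : S} (hx : x ∈ weightedL1 𝕜 μ S hξ hξ0) {η : Ω →ₘ[μ] 𝕜}
    (hη : ∀ᵐ ω ∂μ, ‖η ω‖ ≤ 1) : η • x ∈ weightedL1 𝕜 μ S hξ hξ0 := by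
  refine Integrable.mono' hx (hξ.mul (rn 𝕜 μ (η • x)).measurable).aestronglyMeasurable ?_
  filter_upwards [coeFn_rn_smul η x, hη, coeFn_rn_nonneg 𝕜 μ x] with ω h1 h2 h3
  rw [h1, Real.norm_of_nonneg (mul_nonneg (hξ0 ω) (mul_nonneg (norm_nonneg _) h3))]
  exact mul_le_mul_of_nonneg_left (mul_le_of_le_one_left h3 h2) (hξ0 ω)

theorem norm_ind_le {A : Set Ω} (hA : MeasurableSet A) : ∀ᵐ ω ∂μ, ‖ind 𝕜 μ hA ω‖ ≤ 1 := by
  filter_upwards [coeFn_ind (𝕜 := 𝕜) (μ := μ) hA] with ω h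
  rw [h]
  by_cases h : ω ∈ A <;> simp [h]

variable (𝕜 μ S) in
/-- The seminorm `x ↦ ∫ ξ ‖x‖ dμ`. -/
noncomputable def weightedSeminorm : Seminorm 𝕜 (weightedL1 𝕜 μ S hξ hξ0) :=
  Seminorm.of (fun x => ∫ ω, ξ ω * rn 𝕜 μ (x : S) ω ∂μ)
    (fun x y => by
      have hx : Integrable (fun ω => ξ ω * rn 𝕜 μ (x : S) ω) μ := x.2
      have hy : Integrable (fun ω => ξ ω * rn 𝕜 μ (y : S) ω) μ := y.2
      rw [← integral_add hx hy]
      refine integral_mono_ae (x + y).2 (hx.add hy) ?_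
      filter_upwards [coeFn_rn_add_le 𝕜 μ (x : S) y] with ω h1
      rw [← mul_add]
      exact mul_le_mul_of_nonneg_left h1 (hξ0 ω))
    (fun c x => by
      rw [← integral_const_mul]
      refine integral_congr_ae ?_
      filter_upwards [coeFn_rn_const_smul (μ := μ) c (x : S)] with ω h
      rw [Submodule.coe_smul, h]; ring)

/-- A linear functional on `weightedL1` dominated by `∫ ξ ‖x‖` is disintegrated by an
`L⁰`-valued map dominated by `ξ ‖x‖`. -/
theorem exists_disintegration [SigmaFinite μ] (ψ : weightedL1 𝕜 μ S hξ hξ0 →ₗ[𝕜] 𝕜)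
    (hψ : ∀ x, ‖ψ x‖ ≤ weightedSeminorm 𝕜 μ S hξ hξ0 x) :
    ∃ Φ : weightedL1 𝕜 μ S hξ hξ0 →ₗ[𝕜] (Ω →ₘ[μ] 𝕜),
      (∀ x, ∀ᵐ ω ∂μ, ‖Φ x ω‖ ≤ ξ ω * rn 𝕜 μ (x : S) ω) ∧
      ∀ x, Integrable (Φ x) μ ∧ ∀ A, ∀ hA : MeasurableSet A, ∫ ω in A, Φ x ω ∂μ =
        ψ ⟨ind 𝕜 μ hA • (x : S), smul_mem_weightedL1 hξ hξ0 x.2 (norm_ind_le hA)⟩ := by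
  classical
  -- Multiplication by the indicator of `A`; `A ↦ ψ (T hA x)` is the set function to be
  -- differentiated.
  let T : ∀ {A : Set Ω}, MeasurableSet A → weightedL1 𝕜 μ S hξ hξ0 → weightedL1 𝕜 μ S hξ hξ0 :=
    fun hA x => ⟨ind 𝕜 μ hA • (x : S), smul_mem_weightedL1 hξ hξ0 x.2 (norm_ind_le hA)⟩
  have hTadd : ∀ {A : Set Ω} (hA : MeasurableSet A) x y, T hA (x + y) = T hA x + T hA y :=
    fun hA x y => Subtype.ext (smul_add _ _ _)
  have hTsmul : ∀ {A : Set Ω} (hA : MeasurableSet A) (c : 𝕜) x, T hA (c • x) = c • T hA x :=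
    fun hA c x => Subtype.ext (by
      show ind 𝕜 μ hA • (c • (x : S)) = c • (ind 𝕜 μ hA • (x : S))
      rw [← algebraMap_smul (Ω →ₘ[μ] 𝕜) c (x : S),
        ← algebraMap_smul (Ω →ₘ[μ] 𝕜) c (ind 𝕜 μ hA • (x : S)), smul_smul, smul_smul, mul_comm])
  have hT : ∀ {A : Set Ω} (hA : MeasurableSet A) x,
      ‖ψ (T hA x)‖ ≤ ∫ ω in A, ξ ω * rn 𝕜 μ (x : S) ω ∂μ := by
    intro A hA x
    refine (hψ _).trans_eq ?_
    rw [← integral_indicator hA]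
    refine integral_congr_ae ?_
    filter_upwards [coeFn_rn_smul (ind 𝕜 μ hA) (x : S), coeFn_ind (𝕜 := 𝕜) (μ := μ) hA]
      with ω h1 h2
    rw [h1, h2]
    by_cases h : ω ∈ A <;> simp [h]
  have key : ∀ x : weightedL1 𝕜 μ S hξ hξ0, ∃ g : Ω →ₘ[μ] 𝕜, Integrable g μ ∧
      ∀ A, ∀ hA : MeasurableSet A, ∫ ω in A, g ω ∂μ = ψ (T hA x) := by
    intro x
    have hx : Integrable (fun ω => ξ ω * rn 𝕜 μ (x : S) ω) μ := x.2
    have hx0 : ∀ᵐ ω ∂μ, 0 ≤ ξ ω * rn 𝕜 μ (x : S) ω := by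
      filter_upwards [coeFn_rn_nonneg 𝕜 μ (x : S)] with ω h
      exact mul_nonneg (hξ0 ω) h
    have hfin : IsFiniteMeasure
        (μ.withDensity fun ω => ENNReal.ofReal (ξ ω * rn 𝕜 μ (x : S) ω)) :=
      isFiniteMeasure_withDensity_ofReal hx.2
    obtain ⟨g, hg, hgA⟩ := exists_density (𝕜 := 𝕜) (μ := μ)
      (withDensity_absolutelyContinuous μ
        fun ω => ENNReal.ofReal (ξ ω * rn 𝕜 μ (x : S) ω))
      (fun A => if hA : MeasurableSet A then ψ (T hA x) else 0)
      (fun A hA => by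
        simp only [hA, dif_pos]
        rw [withDensity_apply _ hA, ← ofReal_integral_eq_lintegral_ofReal hx.integrableOn
          (ae_restrict_of_ae hx0), ← ofReal_norm]
        exact ENNReal.ofReal_le_ofReal (hT hA x))
      (fun A B hA hB hAB => by
        simp only [hA, hB, hA.union hB, dif_pos]
        rw [← map_add]
        congr 1
        apply Subtype.ext
        show ind 𝕜 μ (hA.union hB) • (x : S) = ind 𝕜 μ hA • (x : S) + ind 𝕜 μ hB • (x : S)
        rw [ind_union hA hB hAB, add_smul])
    refine ⟨AEEqFun.mk g hg.1, hg.congr (AEEqFun.coeFn_mk _ _).symm, fun A hA => ?_⟩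
    rw [← show (if hA : MeasurableSet A then ψ (T hA x) else 0) = ψ (T hA x) from dif_pos hA,
      ← hgA A hA]
    exact integral_congr_ae (ae_restrict_of_ae (AEEqFun.coeFn_mk _ _))
  choose Φ hΦi hΦ using key
  -- An integrable function is determined by its integrals over measurable sets, so `Φ` inherits
  -- linearity from `ψ`.
  have huniq : ∀ (x) (g : Ω →ₘ[μ] 𝕜), Integrable g μ →
      (∀ A, ∀ hA : MeasurableSet A, ∫ ω in A, g ω ∂μ = ψ (T hA x)) → Φ x = g := by
    intro x g hg h
    refine AEEqFun.ext ((hΦi x).ae_eq_of_forall_setIntegral_eq _ _ hg fun A hA _ => ?_)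
    rw [hΦ x A hA, h A hA]
  have hadd : ∀ x y, Φ (x + y) = Φ x + Φ y := by
    intro x y
    have hae := AEEqFun.coeFn_add (Φ x) (Φ y)
    refine huniq _ _ (((hΦi x).add (hΦi y)).congr hae.symm) fun A hA => ?_
    rw [integral_congr_ae (ae_restrict_of_ae hae)]
    show ∫ ω in A, (Φ x ω + Φ y ω) ∂μ = _
    rw [integral_add (hΦi x).integrableOn (hΦi y).integrableOn, hΦ, hΦ, hTadd, map_add]
  have hsmul : ∀ (c : 𝕜) x, Φ (c • x) = c • Φ x := by
    intro c x
    have hae := AEEqFun.coeFn_smul c (Φ x)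
    refine huniq _ _ (((hΦi x).smul c).congr hae.symm) fun A hA => ?_
    rw [integral_congr_ae (ae_restrict_of_ae hae)]
    show ∫ ω in A, (c • Φ x ω) ∂μ = _
    rw [integral_smul, hΦ, hTsmul, map_smul]
  refine ⟨⟨⟨Φ, hadd⟩, hsmul⟩, fun x => ?_, fun x => ⟨hΦi x, hΦ x⟩⟩
  -- For a fixed constant `c` the inequality can be tested by integrating over each `A`, where it
  -- reduces to the scalar bound `hT`.
  refine ae_norm_le_of_forall_re_mul_le fun c => ?_
  have hx : Integrable (fun ω => ξ ω * rn 𝕜 μ (x : S) ω) μ := x.2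
  refine ae_le_of_forall_setIntegral_le ((hΦi x).const_mul c).re (hx.const_mul ‖c‖)
    fun A hA _ => ?_
  have h1 : ∫ ω in A, RCLike.re (c * Φ x ω) ∂μ = RCLike.re (∫ ω in A, c * Φ x ω ∂μ) :=
    integral_re ((hΦi x).const_mul c).integrableOn
  refine h1.trans_le ?_
  rw [integral_const_mul, integral_const_mul, hΦ x A hA]
  refine (RCLike.re_le_norm _).trans ?_
  rw [norm_mul]
  exact mul_le_mul_of_nonneg_left (hT hA x) (norm_nonneg c)

/-- Linear maps dominated by the `L⁰`-norm are `L⁰`-linear. -/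
theorem map_smul_of_norm_le {V : Submodule 𝕜 S} (Φ : V →ₗ[𝕜] (Ω →ₘ[μ] 𝕜))
    (hΦ : ∀ x, ∀ᵐ ω ∂μ, ‖Φ x ω‖ ≤ ξ ω * rn 𝕜 μ (x : S) ω) (η : Ω →ₘ[μ] 𝕜) (x y : V)
    (hxy : (y : S) = η • (x : S)) : Φ y = η * Φ x := by
  -- For constant `c`, `y - c x = (η - c) x`, so the bound controls `Φ y - c Φ x` by `|η - c|`. Once
  -- the null set no longer depends on `c`, the choice `c = η ω` makes the right-hand side vanish.
  have h1 : ∀ c : 𝕜, ∀ᵐ ω ∂μ,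
      ‖Φ y ω - c * Φ x ω‖ ≤ ξ ω * (‖η ω - c‖ * rn 𝕜 μ (x : S) ω) := by
    intro c
    have h2 : ((y - c • x : V) : S) = (η - algebraMap 𝕜 (Ω →ₘ[μ] 𝕜) c) • (x : S) := by
      rw [sub_smul, algebraMap_smul, ← hxy]; rfl
    have h3 := hΦ (y - c • x)
    rw [h2, map_sub, map_smul] at h3
    filter_upwards [h3, coeFn_rn_smul (η - algebraMap 𝕜 (Ω →ₘ[μ] 𝕜) c) (x : S),
      AEEqFun.coeFn_sub (Φ y) (c • Φ x), AEEqFun.coeFn_smul c (Φ x),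
      AEEqFun.coeFn_sub η (algebraMap 𝕜 (Ω →ₘ[μ] 𝕜) c), coeFn_algebraMap (μ := μ) c]
      with ω h3 h4 h5 h6 h7 h8
    rw [h4, h5, h7, Pi.sub_apply, Pi.sub_apply, h6, h8, Pi.smul_apply, smul_eq_mul] at h3
    exact h3
  have h2 := ae_forall_of_isClosed
    (P := fun c ω => ‖Φ y ω - c * Φ x ω‖ ≤ ξ ω * (‖η ω - c‖ * rn 𝕜 μ (x : S) ω))
    (fun ω => isClosed_le (by fun_prop) (by fun_prop)) h1
  apply AEEqFun.ext
  filter_upwards [h2, coeFn_mul' η (Φ x)] with ω h3 h4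
  have h5 := h3 (η ω)
  rw [sub_self, norm_zero, zero_mul, mul_zero, norm_le_zero_iff, sub_eq_zero] at h5
  rw [h4, h5]

/-- For every `x, y ∈ S` there is an invertible `h ∈ L⁰` with `h x`, `h y` in `weightedL1`. -/
theorem exists_mul_eq_one_smul_mem_weightedL1 [SigmaFinite μ] (x y : S) :
    ∃ h k : Ω →ₘ[μ] 𝕜, h * k = 1 ∧ h • x ∈ weightedL1 𝕜 μ S hξ hξ0 ∧
      h • y ∈ weightedL1 𝕜 μ S hξ hξ0 := by
  obtain ⟨w, hw0, hwm, hw⟩ := exists_pos_lintegral_lt_of_sigmaFinite μ one_ne_zero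
  have hwi : Integrable (fun ω => (w ω : ℝ)) μ := by
    refine ⟨hwm.coe_nnreal_real.aestronglyMeasurable, ?_⟩
    rw [hasFiniteIntegral_iff_enorm]
    refine lt_of_eq_of_lt ?_ (hw.trans ENNReal.one_lt_top)
    simp
  -- With `w` positive and integrable and `h = w / d`, the products `ξ ‖h x‖` and `ξ ‖h y‖` are at
  -- most `w`. The summand `1` keeps `d` positive, so that `h` has inverse `d / w`.
  let d : Ω → ℝ := fun ω => 1 + ξ ω * |rn 𝕜 μ x ω| + ξ ω * |rn 𝕜 μ y ω|
  have hd : Measurable d := by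
    have := (rn 𝕜 μ x).measurable
    have := (rn 𝕜 μ y).measurable
    fun_prop
  have ha : ∀ ω, 0 ≤ ξ ω * |rn 𝕜 μ x ω| := fun ω => mul_nonneg (hξ0 ω) (abs_nonneg _)
  have hb : ∀ ω, 0 ≤ ξ ω * |rn 𝕜 μ y ω| := fun ω => mul_nonneg (hξ0 ω) (abs_nonneg _)
  have hd0 : ∀ ω, 0 < d ω := fun ω => by
    have := ha ω
    have := hb ω
    simp only [d]
    linarith
  have hwr : Measurable fun ω => (w ω : ℝ) := hwm.coe_nnreal_real
  have hhm : Measurable fun ω => (((w ω : ℝ) / d ω : ℝ) : 𝕜) :=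
    RCLike.measurable_ofReal.comp (hwr.div hd)
  have hkm : Measurable fun ω => ((d ω / (w ω : ℝ) : ℝ) : 𝕜) :=
    RCLike.measurable_ofReal.comp (hd.div hwr)
  let h : Ω →ₘ[μ] 𝕜 := AEEqFun.mk _ hhm.aestronglyMeasurable
  let k : Ω →ₘ[μ] 𝕜 := AEEqFun.mk _ hkm.aestronglyMeasurable
  have hh : ∀ᵐ ω ∂μ, h ω = (((w ω : ℝ) / d ω : ℝ) : 𝕜) := AEEqFun.coeFn_mk _ _
  have hk : ∀ᵐ ω ∂μ, k ω = ((d ω / (w ω : ℝ) : ℝ) : 𝕜) := AEEqFun.coeFn_mk _ _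
  have main : ∀ z : S, (∀ ω, ξ ω * |rn 𝕜 μ z ω| ≤ d ω) →
      h • z ∈ weightedL1 𝕜 μ S hξ hξ0 := by
    intro z hz
    refine hwi.mono' (hξ.mul (rn 𝕜 μ (h • z)).measurable).aestronglyMeasurable ?_
    filter_upwards [coeFn_rn_smul h z, hh] with ω h1 h2
    have hwp : (0 : ℝ) ≤ w ω := (w ω).2
    rw [h1, h2, RCLike.norm_ofReal, abs_of_nonneg (div_nonneg hwp (hd0 ω).le), Real.norm_eq_abs,
      abs_mul, abs_mul, abs_of_nonneg (hξ0 ω), abs_of_nonneg (div_nonneg hwp (hd0 ω).le),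
      show ξ ω * (w ω / d ω * |rn 𝕜 μ z ω|) = w ω * ((ξ ω * |rn 𝕜 μ z ω|) / d ω) by ring]
    exact mul_le_of_le_one_right hwp ((div_le_one (hd0 ω)).2 (hz ω))
  refine ⟨h, k, ?_, main x fun ω => ?_, main y fun ω => ?_⟩
  · apply AEEqFun.ext
    filter_upwards [hh, hk, coeFn_mul' h k, AEEqFun.coeFn_one (μ := μ) (β := 𝕜)]
      with ω h1 h2 h3 h4
    have hwp : (w ω : ℝ) ≠ 0 := by exact_mod_cast (hw0 ω).ne'
    have hdp := (hd0 ω).ne'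
    rw [h3, h1, h2, h4, ← RCLike.ofReal_mul,
      show (w ω : ℝ) / d ω * (d ω / w ω) = 1 by field_simp]
    simp
  · have := hb ω
    simp only [d]; linarith
  · have := ha ω
    simp only [d]; linarith

/-- A dominated linear map on `weightedL1` extends to a dominated linear map on `S`. -/
theorem exists_extension_of_weightedL1 [SigmaFinite μ]
    (Φ : weightedL1 𝕜 μ S hξ hξ0 →ₗ[𝕜] (Ω →ₘ[μ] 𝕜))
    (hΦ : ∀ x, ∀ᵐ ω ∂μ, ‖Φ x ω‖ ≤ ξ ω * rn 𝕜 μ (x : S) ω) :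
    ∃ F : S →ₗ[𝕜] (Ω →ₘ[μ] 𝕜), (∀ x : weightedL1 𝕜 μ S hξ hξ0, F (x : S) = Φ x) ∧
      ∀ x, ∀ᵐ ω ∂μ, ‖F x ω‖ ≤ ξ ω * rn 𝕜 μ x ω := by
  have key : ∀ x : S, ∃ h k : Ω →ₘ[μ] 𝕜, h * k = 1 ∧ h • x ∈ weightedL1 𝕜 μ S hξ hξ0 := fun x =>
    let ⟨h, k, h1, h2, _⟩ := exists_mul_eq_one_smul_mem_weightedL1 (𝕜 := 𝕜) (μ := μ) hξ hξ0 x x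
    ⟨h, k, h1, h2⟩
  choose h k hhk hmem using key
  -- `L⁰`-linearity forces this formula. The next claim shows that any other multiplier bringing `x`
  -- into `weightedL1` yields the same value; additivity then uses a common multiplier for `x` and
  -- `y`.
  let F : S → (Ω →ₘ[μ] 𝕜) := fun x => k x * Φ ⟨h x • x, hmem x⟩
  have hF : ∀ (x : S) (a : Ω →ₘ[μ] 𝕜) (y : weightedL1 𝕜 μ S hξ hξ0), (y : S) = a • x →
      Φ y = a * F x := by
    intro x a y hy
    have h1 : (y : S) = (a * k x) • (h x • x) := by
      rw [smul_smul, mul_assoc, mul_comm (k x), hhk, mul_one, hy]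
    rw [map_smul_of_norm_le Φ hΦ (a * k x) ⟨h x • x, hmem x⟩ y h1, mul_assoc]
  have cancel : ∀ {a b u v : Ω →ₘ[μ] 𝕜}, a * b = 1 → a * u = a * v → u = v := by
    intro a b u v hab huv
    calc u = b * (a * u) := by rw [← mul_assoc, mul_comm b, hab, one_mul]
      _ = v := by rw [huv, ← mul_assoc, mul_comm b, hab, one_mul]
  have hadd : ∀ x y, F (x + y) = F x + F y := by
    intro x y
    obtain ⟨a, b, hab, hx, hy⟩ := exists_mul_eq_one_smul_mem_weightedL1 (𝕜 := 𝕜) (μ := μ) hξ hξ0 x y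
    have h1 := hF x a ⟨_, hx⟩ rfl
    have h2 := hF y a ⟨_, hy⟩ rfl
    have h3 := hF (x + y) a (⟨_, hx⟩ + ⟨_, hy⟩) (smul_add a x y).symm
    refine cancel hab ?_
    rw [← h3, map_add, h1, h2, mul_add]
  have hsmul : ∀ (c : 𝕜) x, F (c • x) = c • F x := by
    intro c x
    have h1 := hF x (h x) ⟨_, hmem x⟩ rfl
    have h2 := hF (c • x) (h x) (c • ⟨_, hmem x⟩) (by
      show c • (h x • x) = h x • (c • x)
      rw [← algebraMap_smul (Ω →ₘ[μ] 𝕜) c x, ← algebraMap_smul (Ω →ₘ[μ] 𝕜) c (h x • x),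
        smul_smul, smul_smul, mul_comm])
    refine cancel (hhk x) ?_
    rw [← h2, map_smul, h1, mul_smul_comm]
  refine ⟨⟨⟨F, hadd⟩, hsmul⟩, fun x => ?_, fun x => ?_⟩
  · have h1 := hF (x : S) 1 x (one_smul _ _).symm
    rw [one_mul] at h1
    exact h1.symm
  · show ∀ᵐ ω ∂μ, ‖F x ω‖ ≤ ξ ω * rn 𝕜 μ x ω
    filter_upwards [hΦ ⟨h x • x, hmem x⟩, coeFn_rn_smul (h x) x, coeFn_mul' (h x) (k x),
      AEEqFun.coeFn_one (μ := μ) (β := 𝕜), coeFn_mul' (k x) (Φ ⟨h x • x, hmem x⟩)]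
      with ω h1 h2 h3 h4 h5
    rw [hhk, h4, Pi.one_apply] at h3
    rw [h5, norm_mul]
    calc ‖k x ω‖ * ‖Φ ⟨h x • x, hmem x⟩ ω‖ ≤ ‖k x ω‖ * (ξ ω * (‖h x ω‖ * rn 𝕜 μ x ω)) := by
          rw [← h2]; exact mul_le_mul_of_nonneg_left h1 (norm_nonneg _)
      _ = ‖h x ω * k x ω‖ * (ξ ω * rn 𝕜 μ x ω) := by rw [norm_mul]; ring
      _ = ξ ω * rn 𝕜 μ x ω := by rw [← h3, norm_one, one_mul]

/-- Random Hahn–Banach theorem: a dominated linear map that commutes with indicators extends from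
a subspace stable under indicators to the whole RN module, with the same bound. -/
theorem exists_extension_of_norm_le [SigmaFinite μ] {W : Submodule 𝕜 S}
    (hW : W ≤ weightedL1 𝕜 μ S hξ hξ0) (f : W →ₗ[𝕜] (Ω →ₘ[μ] 𝕜))
    (hf : ∀ x, ∀ᵐ ω ∂μ, ‖f x ω‖ ≤ ξ ω * rn 𝕜 μ (x : S) ω)
    (hind : ∀ A, ∀ hA : MeasurableSet A, ∀ x : W, ind 𝕜 μ hA • (x : S) ∈ W) :
    ∃ F : S →ₗ[𝕜] (Ω →ₘ[μ] 𝕜), (∀ x : W, F (x : S) = f x) ∧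
      ∀ x, ∀ᵐ ω ∂μ, ‖F x ω‖ ≤ ξ ω * rn 𝕜 μ x ω := by
  let V := weightedL1 𝕜 μ S hξ hξ0
  have hfi : ∀ x, Integrable (f x) μ := fun x =>
    Integrable.mono' (hW x.2) (f x).aestronglyMeasurable (hf x)
  -- The integral turns `f` into a scalar functional, to which the classical Hahn–Banach theorem
  -- applies.
  let φ : W →ₗ[𝕜] 𝕜 :=
    { toFun := fun x => ∫ ω, f x ω ∂μ
      map_add' := fun x y => by
        rw [← integral_add (hfi x) (hfi y), map_add]
        exact integral_congr_ae (AEEqFun.coeFn_add _ _)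
      map_smul' := fun c x => by
        rw [RingHom.id_apply, ← integral_smul, map_smul]
        exact integral_congr_ae (AEEqFun.coeFn_smul _ _) }
  let W' : Submodule 𝕜 V := W.comap V.subtype
  let r : W' →ₗ[𝕜] W := (V.subtype.comp W'.subtype).codRestrict W fun x => x.2
  obtain ⟨ψ, hψφ, hψ⟩ := Module.Dual.exists_extension_of_le_seminorm W' (φ ∘ₗ r)
    (p := weightedSeminorm 𝕜 μ S hξ hξ0) (fun x => by
      refine (norm_integral_le_integral_norm _).trans ?_
      exact integral_mono_ae (hfi _).norm (hW (r x).2) (hf (r x)))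
  obtain ⟨Φ, hΦ, hΦψ⟩ := exists_disintegration hξ hξ0 ψ hψ
  obtain ⟨F, hF, hFle⟩ := exists_extension_of_weightedL1 hξ hξ0 Φ hΦ
  refine ⟨F, fun x => ?_, hFle⟩
  have h1 : F (x : S) = Φ ⟨x, hW x.2⟩ := hF ⟨x, hW x.2⟩
  rw [h1]
  -- The `L⁰`-valued `f x` is recovered from its scalar integral: over each `A` both sides integrate
  -- to `φ (1_A x)`, since `1_A x` stays in `W` and `f (1_A x) = 1_A f x`.
  refine AEEqFun.ext ((hΦψ _).1.ae_eq_of_forall_setIntegral_eq _ _ (hfi x) fun A hA _ => ?_)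
  rw [(hΦψ _).2 A hA, setIntegral_eq_integral_ind_mul hA,
    ← map_smul_of_norm_le f hf (ind 𝕜 μ hA) x ⟨_, hind A hA x⟩ rfl]
  exact hψφ ⟨⟨_, hW (hind A hA x)⟩, hind A hA x⟩

end Weighted

end RN

/-! ### Essential suprema of directed families -/

section EssentialSupremum

variable {Ω : Type*} [MeasurableSpace Ω] {μ : Measure Ω}

/-- The essential supremum of an upward directed family of functions is the supremum of an a.e.
nondecreasing sequence of members of the family. -/
theorem exists_seq_ae_le_iSup [SigmaFinite μ] {ι : Type*} [Nonempty ι] (g : ι → Ω → ℝ≥0∞)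
    (hg : ∀ i, Measurable (g i)) (hdir : ∀ i j, ∃ k, g i ≤ᵐ[μ] g k ∧ g j ≤ᵐ[μ] g k) :
    ∃ u : ℕ → ι, (∀ n, g (u n) ≤ᵐ[μ] g (u (n + 1))) ∧
      ∀ i, g i ≤ᵐ[μ] fun ω => ⨆ n, g (u n) ω := by
  -- A finite functional, strictly decreasing up to null sets even for functions taking the value
  -- `∞`; minimising it locates the essential supremum.
  let φ : (Ω → ℝ≥0∞) → ℝ≥0∞ := fun h => ∫⁻ ω, (1 + h ω)⁻¹ ∂μ.toFinite
  have hanti : ∀ h k : Ω → ℝ≥0∞, h ≤ᵐ[μ] k → φ k ≤ φ h := fun h k hk =>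
    lintegral_mono_ae ((toFinite_absolutelyContinuous μ).ae_le (hk.mono fun ω hω => by
      exact ENNReal.inv_le_inv.2 (add_le_add le_rfl hω)))
  have hfin : ∀ h : Ω → ℝ≥0∞, φ h ≠ ∞ := fun h => by
    refine ((lintegral_mono (g := fun _ => 1) fun ω => ?_).trans_lt ?_).ne
    · exact ENNReal.inv_le_one.2 le_self_add
    · rw [lintegral_one]; exact measure_lt_top _ _
  obtain ⟨v, -, hv, hvm⟩ := exists_seq_tendsto_sInf (Set.range_nonempty fun i => φ (g i))
    (OrderBot.bddBelow _)
  choose i hi using hvm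
  choose ub hub1 hub2 using hdir
  -- Directedness replaces the minimising sequence `i` by an a.e. nondecreasing one: `u (n + 1)`
  -- dominates both `u n` and `i (n + 1)`.
  let u : ℕ → ι := fun n => Nat.rec (i 0) (fun n k => ub k (i (n + 1))) n
  have hmono : ∀ n, g (u n) ≤ᵐ[μ] g (u (n + 1)) := fun n => hub1 _ _
  have hui : ∀ n, g (i n) ≤ᵐ[μ] g (u n) := by
    intro n
    cases n with
    | zero => exact EventuallyLE.rfl
    | succ n => exact hub2 _ _
  refine ⟨u, hmono, fun j => ?_⟩
  set s := sInf (Set.range fun i => φ (g i))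
  have hGs : φ (fun ω => ⨆ n, g (u n) ω) ≤ s := by
    refine ge_of_tendsto' hv fun n => ?_
    rw [← hi n]
    exact hanti _ _ ((hui n).mono fun ω h => h.trans (le_iSup (fun n => g (u n) ω) n))
  -- Adjoining `g j` to the supremum cannot bring `φ` below `s`: each `max (g (u n)) (g j)` lies
  -- a.e. below a member of the family, and `φ` passes to the monotone limit.
  have hmax : s ≤ φ (fun ω => ⨆ n, max (g (u n) ω) (g j ω)) := by
    have h1 : φ (fun ω => ⨆ n, max (g (u n) ω) (g j ω)) =
        ⨅ n, φ (fun ω => max (g (u n) ω) (g j ω)) := by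
      have h2 : ∀ ω, (1 + ⨆ n, max (g (u n) ω) (g j ω))⁻¹ =
          ⨅ n, (1 + max (g (u n) ω) (g j ω))⁻¹ := fun ω => by
        rw [ENNReal.add_iSup, ENNReal.inv_iSup]
      simp only [φ, h2]
      refine lintegral_iInf_ae (fun n => ?_) (fun n => ?_) (hfin _)
      · exact (((hg _).max (hg j)).const_add 1).inv
      · refine (toFinite_absolutelyContinuous μ).ae_le ((hmono n).mono fun ω hω => ?_)
        exact ENNReal.inv_le_inv.2 (add_le_add le_rfl (max_le_max_right _ hω))
    rw [h1]
    refine le_iInf fun n => ?_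
    refine (sInf_le (Set.mem_range_self (ub (u n) j))).trans (hanti _ _ ?_)
    filter_upwards [hub1 (u n) j, hub2 (u n) j] with ω h3 h4
    exact max_le h3 h4
  have hle : ∀ ω, ⨆ n, g (u n) ω ≤ ⨆ n, max (g (u n) ω) (g j ω) := fun ω =>
    iSup_mono fun n => le_max_left _ _
  have hGm : Measurable fun ω => ⨆ n, g (u n) ω := .iSup fun n => hg _
  -- Ordered integrands whose finite integrals agree are a.e. equal, so adjoining `g j` changes
  -- nothing.
  have hae := ae_eq_of_ae_le_of_lintegral_le (μ := μ.toFinite)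
    (f := fun ω => (1 + ⨆ n, max (g (u n) ω) (g j ω))⁻¹) (g := fun ω => (1 + ⨆ n, g (u n) ω)⁻¹)
    (Eventually.of_forall fun ω => ENNReal.inv_le_inv.2 (add_le_add le_rfl (hle ω)))
    (hfin _) ((hGm.const_add 1).inv.aemeasurable) (hGs.trans hmax)
  filter_upwards [(absolutelyContinuous_toFinite μ).ae_le hae] with ω hω
  have h5 := inv_injective hω
  have h6 := (ENNReal.add_right_inj ENNReal.one_ne_top).1 h5
  exact (le_max_right _ _).trans ((le_iSup (fun n => max (g (u n) ω) (g j ω)) 0).trans_eq h6)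

end EssentialSupremum

/-! ### Converse of Hölder's inequality -/

section Duality

variable {Ω : Type*} [MeasurableSpace Ω] {μ : Measure Ω}

/-- Converse of Hölder's inequality in the reflexive range. -/
theorem lintegral_rpow_le_of_forall_lintegral_mul_le [SigmaFinite μ] {r s : ℝ}
    (hrs : s.HolderConjugate r) {G : Ω → ℝ≥0∞} (hG : Measurable G) {c : ℝ≥0∞}
    (H : ∀ η : Ω → NNReal, Measurable η → (∃ C, ∀ ω, η ω ≤ C) →
      ∫⁻ ω, (η ω : ℝ≥0∞) ^ s ∂μ < ∞ →
      ∫⁻ ω, η ω * G ω ∂μ ≤ c * (∫⁻ ω, (η ω : ℝ≥0∞) ^ s ∂μ) ^ (1 / s)) :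
    ∫⁻ ω, G ω ^ r ∂μ ≤ c ^ r := by
  classical
  have hr0 : 0 < r := hrs.symm.pos
  have hr1 : 0 < r - 1 := sub_pos.2 hrs.symm.lt
  let A := spanningSets μ
  have hA : ∀ n, MeasurableSet (A n) := measurableSet_spanningSets μ
  -- Truncating both the values and the support makes the integral of `Gn ^ r` finite, which is
  -- needed to divide by a power of it.
  let Gn : ℕ → Ω → ℝ≥0∞ := fun n => (A n).indicator fun ω => min (G ω) n
  have hGnm : ∀ n, Measurable (Gn n) := fun n => (hG.min measurable_const).indicator (hA n)
  have hGn_le : ∀ n ω, Gn n ω ≤ G ω := fun n ω => by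
    by_cases h : ω ∈ A n <;> simp [Gn, h]
  have hGn_le' : ∀ n ω, Gn n ω ≤ n := fun n ω => by
    by_cases h : ω ∈ A n <;> simp [Gn, h]
  have hmono : ∀ ω, Monotone fun n => Gn n ω := by
    intro ω m n hmn
    by_cases h : ω ∈ A m
    · have h' : ω ∈ A n := monotone_spanningSets μ hmn h
      simp only [Gn, h, h', Set.indicator_of_mem]
      exact min_le_min_left _ (by exact_mod_cast hmn)
    · simp [Gn, h]
  have hlim : ∀ ω, Tendsto (fun n => Gn n ω) atTop (𝓝 (G ω)) := by
    intro ω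
    have h1 : Tendsto (fun n : ℕ => min (G ω) n) atTop (𝓝 (min (G ω) ∞)) :=
      tendsto_const_nhds.min ENNReal.tendsto_nat_nhds_top
    rw [min_eq_left le_top] at h1
    refine h1.congr' ?_
    filter_upwards [eventually_ge_atTop (spanningSetsIndex μ ω)] with n hn
    have : ω ∈ A n := mem_spanningSets_of_index_le μ ω hn
    simp [Gn, this]
  have hI : ∀ n, ∫⁻ ω, Gn n ω ^ r ∂μ ≤ c ^ r := by
    intro n
    set I := ∫⁻ ω, Gn n ω ^ r ∂μ with hIdef
    have hIfin : I < ∞ := by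
      refine (lintegral_mono (g := (A n).indicator fun _ => (n : ℝ≥0∞) ^ r) fun ω => ?_).trans_lt ?_
      · by_cases h : ω ∈ A n
        · simp only [h, Set.indicator_of_mem]
          exact ENNReal.rpow_le_rpow (hGn_le' n ω) hr0.le
        · simp [Gn, h, hr0]
      · rw [lintegral_indicator (hA n), setLIntegral_const]
        exact ENNReal.mul_lt_top (ENNReal.rpow_lt_top_of_nonneg hr0.le (ENNReal.natCast_ne_top n))
          (measure_spanningSets_lt_top μ n)
    have hfin : ∀ ω, Gn n ω ^ (r - 1) ≠ ∞ := fun ω =>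
      ENNReal.rpow_ne_top_of_nonneg hr1.le
        ((hGn_le' n ω).trans_lt (ENNReal.natCast_lt_top n)).ne
    -- The equality case of Hölder's inequality: `η ^ s = Gn ^ r`, while `η * G ≥ Gn ^ r`.
    let η : Ω → NNReal := fun ω => (Gn n ω ^ (r - 1)).toNNReal
    have hη : ∀ ω, (η ω : ℝ≥0∞) = Gn n ω ^ (r - 1) := fun ω => ENNReal.coe_toNNReal (hfin ω)
    have hηs : ∀ ω, (η ω : ℝ≥0∞) ^ s = Gn n ω ^ r := fun ω => by
      rw [hη, ← ENNReal.rpow_mul, hrs.symm.sub_one_mul_conj]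
    have hηG : ∀ ω, Gn n ω ^ r ≤ η ω * G ω := fun ω => by
      rw [hη]
      refine le_trans (le_of_eq ?_) (mul_le_mul' le_rfl (hGn_le n ω))
      conv_lhs => rw [show r = (r - 1) + 1 by ring]
      rw [ENNReal.rpow_add_of_nonneg _ _ hr1.le zero_le_one, ENNReal.rpow_one]
    have h1 := H η ((hGnm n).pow_const _).ennreal_toNNReal
      ⟨((n : ℝ≥0∞) ^ (r - 1)).toNNReal, fun ω => ENNReal.toNNReal_mono
        (ENNReal.rpow_ne_top_of_nonneg hr1.le (ENNReal.natCast_ne_top n))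
        (ENNReal.rpow_le_rpow (hGn_le' n ω) hr1.le)⟩ (by simpa only [hηs] using hIfin)
    simp only [hηs, ← hIdef] at h1
    have h2 : I ≤ c * I ^ (1 / s) := (lintegral_mono hηG).trans h1
    rcases eq_or_ne I 0 with h0 | h0
    · rw [h0]; exact zero_le
    have h3 : I = I ^ (1 / r) * I ^ (1 / s) := by
      rw [← ENNReal.rpow_add _ _ h0 hIfin.ne, one_div, one_div, add_comm, hrs.inv_add_inv_eq_one,
        ENNReal.rpow_one]
    have h4 : I ^ (1 / s) ≠ 0 := (ENNReal.rpow_pos (pos_iff_ne_zero.2 h0) hIfin.ne).ne'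
    have h5 : I ^ (1 / s) ≠ ∞ :=
      ENNReal.rpow_ne_top_of_nonneg (one_div_nonneg.2 hrs.pos.le) hIfin.ne
    have h6 : I ^ (1 / r) ≤ c := by
      rw [← ENNReal.mul_le_mul_iff_left h4 h5, ← h3]
      exact h2
    calc I = (I ^ (1 / r)) ^ r := by
          rw [← ENNReal.rpow_mul, one_div_mul_cancel hr0.ne', ENNReal.rpow_one]
      _ ≤ c ^ r := ENNReal.rpow_le_rpow h6 hr0.le
  have hT : Tendsto (fun n => ∫⁻ ω, Gn n ω ^ r ∂μ) atTop (𝓝 (∫⁻ ω, G ω ^ r ∂μ)) :=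
    lintegral_tendsto_of_tendsto_of_monotone (fun n => ((hGnm n).pow_const r).aemeasurable)
      (Eventually.of_forall fun ω m n hmn => ENNReal.rpow_le_rpow (hmono ω hmn) hr0.le)
      (Eventually.of_forall fun ω => (ENNReal.continuous_rpow_const.tendsto _).comp (hlim ω))
  exact le_of_tendsto' hT hI

/-- Converse of Hölder's inequality. -/
theorem eLpNorm_le_of_forall_lintegral_mul_le [SigmaFinite μ] {p q : ℝ≥0∞}
    (hpq : p⁻¹ + q⁻¹ = 1) {G : Ω → ℝ≥0∞} (hG : Measurable G) {c : ℝ≥0∞}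
    (H : ∀ η : Ω → NNReal, Measurable η → (∃ C, ∀ ω, η ω ≤ C) → eLpNorm η p μ < ∞ →
      ∫⁻ ω, η ω * G ω ∂μ ≤ c * eLpNorm η p μ) :
    eLpNorm G q μ ≤ c := by
  classical
  -- At `p = ∞` the constant `1` is the test function; at `q = ∞` indicators of sets of finite
  -- measure are.
  rcases eq_or_ne p ∞ with rfl | hp
  · have hq : q = 1 := by simpa using hpq
    have h1 : eLpNorm (fun _ : Ω => (1 : NNReal)) ∞ μ ≤ 1 := by
      rw [eLpNorm_exponent_top]
      exact eLpNormEssSup_le_of_ae_enorm_bound (Eventually.of_forall fun ω => le_rfl)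
    have h2 := H (fun _ => 1) measurable_const ⟨1, fun _ => le_rfl⟩ (h1.trans_lt ENNReal.one_lt_top)
    rw [hq, eLpNorm_one_eq_lintegral_enorm]
    simp only [ENNReal.coe_one, one_mul] at h2
    exact h2.trans (mul_le_of_le_one_right' h1)
  rcases eq_or_ne q ∞ with rfl | hq
  · have hp1 : p = 1 := by simpa using hpq
    subst hp1
    rw [eLpNorm_exponent_top]
    refine eLpNormEssSup_le_of_ae_enorm_bound ?_
    refine ae_le_of_forall_setLIntegral_le_of_sigmaFinite hG fun A hA hAfin => ?_
    have h0 : ∀ ω, ((A.indicator (fun _ => (1 : NNReal)) ω : NNReal) : ℝ≥0∞) =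
        A.indicator (fun _ => 1) ω := fun ω => by
      by_cases h : ω ∈ A <;> simp [h]
    have h1 : eLpNorm (A.indicator fun _ => (1 : NNReal)) 1 μ = μ A := by
      rw [eLpNorm_one_eq_lintegral_enorm]
      refine (lintegral_congr h0).trans ?_
      rw [lintegral_indicator hA, setLIntegral_one]
    have h2 := H (A.indicator fun _ => 1) (measurable_const.indicator hA)
      ⟨1, fun ω => Set.indicator_le_self' (fun _ _ => zero_le) ω⟩ (h1 ▸ hAfin)
    rw [h1] at h2
    rw [setLIntegral_const, ← lintegral_indicator hA]
    refine le_trans (le_of_eq (lintegral_congr fun ω => ?_)) h2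
    rw [h0]
    by_cases h : ω ∈ A <;> simp [h]
  have hp0 : p ≠ 0 := by rintro rfl; simp at hpq
  have hq0 : q ≠ 0 := by rintro rfl; simp at hpq
  have hconj : p.toReal.HolderConjugate q.toReal := by
    have hpi : p⁻¹ ≠ ∞ := ENNReal.inv_ne_top.2 hp0
    have hqi : q⁻¹ ≠ ∞ := ENNReal.inv_ne_top.2 hq0
    refine ⟨?_, ENNReal.toReal_pos hp0 hp, ENNReal.toReal_pos hq0 hq⟩
    rw [← ENNReal.toReal_inv, ← ENNReal.toReal_inv, ← ENNReal.toReal_add hpi hqi, hpq]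
    simp
  rw [eLpNorm_eq_lintegral_rpow_enorm_toReal hq0 hq, one_div,
    ENNReal.rpow_inv_le_iff (ENNReal.toReal_pos hq0 hq)]
  refine lintegral_rpow_le_of_forall_lintegral_mul_le hconj hG fun η hη hC hfin => ?_
  have h1 : eLpNorm η p μ = (∫⁻ ω, (η ω : ℝ≥0∞) ^ p.toReal ∂μ) ^ (1 / p.toReal) :=
    eLpNorm_eq_lintegral_rpow_enorm_toReal hp0 hp
  rw [← h1]
  refine H η hη hC ?_
  rw [h1]
  exact ENNReal.rpow_lt_top_of_nonneg (by positivity) hfin.ne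

/-- This permits passing from an essential supremum in `[0, ∞]` to a real weight. The exponent `0`
is excluded because `eLpNorm` vanishes there. -/
theorem ae_lt_top_of_eLpNorm_lt_top {q : ℝ≥0∞} (hq : q ≠ 0) {G : Ω → ℝ≥0∞} (hG : Measurable G)
    (h : eLpNorm G q μ < ∞) : ∀ᵐ ω ∂μ, G ω < ∞ := by
  rcases eq_or_ne q ∞ with rfl | hq'
  · rw [eLpNorm_exponent_top] at h
    filter_upwards [enorm_ae_le_eLpNormEssSup G μ] with ω hω
    exact lt_of_le_of_lt hω h
  · have hpos := ENNReal.toReal_pos hq hq'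
    have h1 := lintegral_rpow_enorm_lt_top_of_eLpNorm_lt_top hq hq' h
    filter_upwards [ae_lt_top (hG.pow_const _) h1.ne] with ω hω
    by_contra h2
    rw [not_lt, top_le_iff] at h2
    simp [h2, hpos] at hω

end Duality

/-! ### Module homomorphisms into `L¹` and their norms -/

section ModuleDual

variable {𝕜 : Type*} [RCLike 𝕜] {Ω : Type*} [MeasurableSpace Ω] {μ : Measure Ω}

theorem coeFn_smul_Lp {p : ℝ≥0∞} (η : LInfty 𝕜 μ) (g : Lp 𝕜 p μ) :
    ∀ᵐ ω ∂μ, (η • g : Lp 𝕜 p μ) ω = LInfty.toL0 𝕜 μ η ω * g ω :=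
  coeFn_mul' (LInfty.toL0 𝕜 μ η) (g : Ω →ₘ[μ] 𝕜)

theorem exists_LInfty_of_bound {h : Ω → 𝕜} (hm : Measurable h) {C : ℝ} (hC : ∀ ω, ‖h ω‖ ≤ C) :
    ∃ η : LInfty 𝕜 μ, ∀ᵐ ω ∂μ, LInfty.toL0 𝕜 μ η ω = h ω := by
  have h1 : ∀ᵐ ω ∂μ, AEEqFun.mk h hm.aestronglyMeasurable ω = h ω := AEEqFun.coeFn_mk _ _
  have h2 : AEEqFun.mk h hm.aestronglyMeasurable ∈ linftySubalgebra 𝕜 μ := by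
    show eLpNorm _ ∞ μ < ∞
    rw [eLpNorm_congr_ae h1, eLpNorm_exponent_top]
    exact eLpNormEssSup_lt_top_of_ae_bound (Eventually.of_forall hC)
  exact ⟨(⟨_, h2⟩ : linftySubalgebra 𝕜 μ), h1⟩

theorem toL0_algebraMap (c : 𝕜) :
    LInfty.toL0 𝕜 μ (algebraMap 𝕜 (LInfty 𝕜 μ) c) = algebraMap 𝕜 (Ω →ₘ[μ] 𝕜) c :=
  AlgHom.commutes _ _

theorem lintegral_enorm_Lp_one (g : Lp 𝕜 1 μ) : ∫⁻ ω, ‖g ω‖ₑ ∂μ = ‖g‖ₑ := by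
  rw [← eLpNorm_one_eq_lintegral_enorm, Lp.enorm_def]

section OperatorNorm

variable {N : Type*} [NormedAddCommGroup N] [Module (LInfty 𝕜 μ) N]

theorem map_algebraMap_smul (f : ModuleDual 𝕜 μ N) (c : 𝕜) (x : N) :
    ∫⁻ ω, ‖f (algebraMap 𝕜 (LInfty 𝕜 μ) c • x) ω‖ₑ ∂μ = ‖c‖ₑ * ∫⁻ ω, ‖f x ω‖ₑ ∂μ := by
  rw [map_smul, ← lintegral_const_mul' _ _ enorm_ne_top]
  refine lintegral_congr_ae ?_
  filter_upwards [coeFn_smul_Lp (algebraMap 𝕜 (LInfty 𝕜 μ) c) (f x),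
    coeFn_algebraMap (μ := μ) c] with ω h1 h2
  rw [h1, toL0_algebraMap, h2, enorm_mul]

theorem le_moduleDualNorm (f : ModuleDual 𝕜 μ N) {x : N} (hx : ‖x‖ ≤ 1) :
    ∫⁻ ω, ‖f x ω‖ₑ ∂μ ≤ moduleDualNorm f :=
  le_iSup (fun x : {x : N // ‖x‖ ≤ 1} => ∫⁻ ω, ‖f x.1 ω‖ₑ ∂μ) ⟨x, hx⟩

/-- Rescaling to the unit ball. The assumptions on `N` contain no compatibility between norm and
scalars, so homogeneity under the constants of `L^∞` enters as `hN`. -/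
theorem lintegral_le_moduleDualNorm_mul
    (hN : ∀ (c : 𝕜) (x : N), ‖algebraMap 𝕜 (LInfty 𝕜 μ) c • x‖ = ‖c‖ * ‖x‖)
    (f : ModuleDual 𝕜 μ N) (x : N) :
    ∫⁻ ω, ‖f x ω‖ₑ ∂μ ≤ moduleDualNorm f * ‖x‖ₑ := by
  rcases eq_or_ne x 0 with rfl | hx
  · rw [map_zero, lintegral_enorm_Lp_one, enorm_zero]
    exact zero_le
  have hx0 : 0 < ‖x‖ := norm_pos_iff.2 hx
  have h1 := le_moduleDualNorm f (x := algebraMap 𝕜 (LInfty 𝕜 μ) ((‖x‖⁻¹ : ℝ) : 𝕜) • x) (by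
    rw [hN, RCLike.norm_ofReal, abs_inv, abs_norm, inv_mul_cancel₀ hx0.ne'])
  have h2 : ‖((‖x‖⁻¹ : ℝ) : 𝕜)‖ₑ = ‖x‖ₑ⁻¹ := by
    rw [← ofReal_norm, RCLike.norm_ofReal, abs_inv, abs_norm, ENNReal.ofReal_inv_of_pos hx0,
      ofReal_norm]
  rw [map_algebraMap_smul, h2] at h1
  calc ∫⁻ ω, ‖f x ω‖ₑ ∂μ = (‖x‖ₑ⁻¹ * ∫⁻ ω, ‖f x ω‖ₑ ∂μ) * ‖x‖ₑ := by
        rw [mul_comm, ← mul_assoc, ENNReal.mul_inv_cancel (by simpa using hx) enorm_ne_top, one_mul]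
    _ ≤ _ := mul_le_mul' h1 le_rfl

/-- Continuity at `0` with tolerance `1` gives a radius `δ`; scaling by `δ / 2` moves the closed
unit ball strictly inside it, whence the bound `2 / δ`. -/
theorem moduleDualNorm_lt_top
    (hN : ∀ (c : 𝕜) (x : N), ‖algebraMap 𝕜 (LInfty 𝕜 μ) c • x‖ = ‖c‖ * ‖x‖)
    (f : ModuleDual 𝕜 μ N) : moduleDualNorm f < ∞ := by
  obtain ⟨δ, hδ, h⟩ := Metric.continuous_iff.1 f.continuous 0 1 one_pos
  have hδ2 : 0 < δ / 2 := half_pos hδ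
  have h1 : ∀ x : {x : N // ‖x‖ ≤ 1}, ∫⁻ ω, ‖f x.1 ω‖ₑ ∂μ ≤ (ENNReal.ofReal (δ / 2))⁻¹ := by
    rintro ⟨x, hx⟩
    have h2 : ‖algebraMap 𝕜 (LInfty 𝕜 μ) ((δ / 2 : ℝ) : 𝕜) • x‖ < δ := by
      rw [hN, RCLike.norm_ofReal, abs_of_pos hδ2]
      nlinarith
    have h3 := h _ (by rwa [dist_zero_right])
    rw [map_zero, dist_zero_right] at h3
    have h4 := map_algebraMap_smul f ((δ / 2 : ℝ) : 𝕜) x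
    rw [lintegral_enorm_Lp_one, ← ofReal_norm, ← ofReal_norm, RCLike.norm_ofReal,
      abs_of_pos hδ2] at h4
    rw [← one_div, ENNReal.le_div_iff_mul_le (Or.inl (ENNReal.ofReal_pos.2 hδ2).ne')
      (Or.inl ENNReal.ofReal_ne_top), mul_comm, ← h4]
    exact ENNReal.ofReal_le_one.2 h3.le
  exact (iSup_le h1).trans_lt (ENNReal.inv_lt_top.2 (ENNReal.ofReal_pos.2 hδ2))

end OperatorNorm

variable {S : Type*} [AddCommGroup S] [Module 𝕜 S] [Module (Ω →ₘ[μ] 𝕜) S]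
  [IsScalarTower 𝕜 (Ω →ₘ[μ] 𝕜) S] [RNModule 𝕜 μ S]

theorem LpRN.enorm_eq {p : ℝ≥0∞} [Fact (1 ≤ p)] (x : LpRN 𝕜 μ S p) :
    ‖x‖ₑ = eLpNorm (rn 𝕜 μ (x : S)) p μ := by
  rw [← ofReal_norm]
  exact ENNReal.ofReal_toReal x.eLpNorm_lt_top.ne

theorem LpRN.norm_algebraMap_smul {p : ℝ≥0∞} [Fact (1 ≤ p)] (c : 𝕜) (x : LpRN 𝕜 μ S p) :
    ‖algebraMap 𝕜 (LInfty 𝕜 μ) c • x‖ = ‖c‖ * ‖x‖ := by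
  have h1 : eLpNorm (rn 𝕜 μ ((algebraMap 𝕜 (LInfty 𝕜 μ) c • x : LpRN 𝕜 μ S p) : S)) p μ =
      ‖c‖ₑ * eLpNorm (rn 𝕜 μ (x : S)) p μ := by
    have h2 : ((algebraMap 𝕜 (LInfty 𝕜 μ) c • x : LpRN 𝕜 μ S p) : S) = c • (x : S) := by
      show LInfty.toL0 𝕜 μ (algebraMap 𝕜 (LInfty 𝕜 μ) c) • (x : S) = _
      rw [toL0_algebraMap, algebraMap_smul]
    rw [h2, eLpNorm_congr_ae (coeFn_rn_const_smul (μ := μ) c (x : S))]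
    have h3 := eLpNorm_const_smul (‖c‖ : ℝ) (rn 𝕜 μ (x : S)) p μ
    rw [enorm_norm] at h3
    exact h3
  show (eLpNorm _ p μ).toReal = ‖c‖ * (eLpNorm _ p μ).toReal
  rw [h1, ENNReal.toReal_mul, toReal_enorm]

/-- Hölder's inequality for the pairing of `S` with `S*`. -/
theorem lintegral_enorm_le_conjNorm_mul [SigmaFinite μ] {p q : ℝ≥0∞} (hpq : p⁻¹ + q⁻¹ = 1)
    (F : RandomConj 𝕜 μ S) (x : S) :
    ∫⁻ ω, ‖(F : S →ₗ[𝕜] (Ω →ₘ[μ] 𝕜)) x ω‖ₑ ∂μ ≤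
      eLpNorm (conjNorm 𝕜 μ F) q μ * eLpNorm (rn 𝕜 μ x) p μ := by
  have : ENNReal.HolderTriple q p 1 := ⟨by rw [add_comm, hpq, inv_one]⟩
  refine le_trans ?_ (eLpNorm_smul_le_mul_eLpNorm (r := 1) (rn 𝕜 μ x).aestronglyMeasurable
    (conjNorm 𝕜 μ F).aestronglyMeasurable)
  rw [eLpNorm_one_eq_lintegral_enorm]
  refine lintegral_mono_ae ?_
  filter_upwards [((mem_randomBounds_iff 𝕜 μ).1 (conjNorm_mem 𝕜 μ F)).2 x] with ω h
  rw [enorm_le_iff_norm_le, Pi.smul_apply', smul_eq_mul, Real.norm_eq_abs]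
  exact h.trans (le_abs_self _)

/-! ### Domination of a module homomorphism by a random weight -/

section Submodule

variable {p : ℝ≥0∞} [Fact (1 ≤ p)] (M : Submodule (LInfty 𝕜 μ) (LpRN 𝕜 μ S p))

theorem norm_algebraMap_smul_coe (c : 𝕜) (x : M) :
    ‖algebraMap 𝕜 (LInfty 𝕜 μ) c • x‖ = ‖c‖ * ‖x‖ :=
  LpRN.norm_algebraMap_smul c (x : LpRN 𝕜 μ S p)

/-- A submodule of `L^p(S)`, regarded as a `𝕜`-subspace of `S`. -/
def carrierSubmodule : Submodule 𝕜 S where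
  carrier := {x | ∃ h : x ∈ lpAddSubgroup 𝕜 μ S p, (⟨x, h⟩ : lpAddSubgroup 𝕜 μ S p) ∈ M}
  zero_mem' := ⟨_, M.zero_mem⟩
  add_mem' := by
    rintro x y ⟨hx, hx'⟩ ⟨hy, hy'⟩
    exact ⟨_, M.add_mem hx' hy'⟩
  smul_mem' := by
    rintro c x ⟨hx, hx'⟩
    have h1 := M.smul_mem (algebraMap 𝕜 (LInfty 𝕜 μ) c) hx'
    have h2 : c • x = LInfty.toL0 𝕜 μ (algebraMap 𝕜 (LInfty 𝕜 μ) c) • x := by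
      rw [toL0_algebraMap, algebraMap_smul]
    rw [Set.mem_ofPred_eq, h2]
    exact ⟨_, h1⟩

variable {M}

/-- The element of `M` underlying an element of `carrierSubmodule M`. -/
def toSubmodule (x : carrierSubmodule M) : M := ⟨⟨x.1, x.2.1⟩, x.2.2⟩

/-- A module homomorphism on `M`, regarded as an `L⁰`-valued map on a subspace of `S`. -/
noncomputable def ModuleDual.toLinearMap (f : ModuleDual 𝕜 μ M) : carrierSubmodule M →ₗ[𝕜] (Ω →ₘ[μ] 𝕜) where
  toFun x := (f (toSubmodule x) : Ω →ₘ[μ] 𝕜)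
  map_add' x y := by
    show (f (toSubmodule x + toSubmodule y) : Ω →ₘ[μ] 𝕜) = _
    rw [map_add]; rfl
  map_smul' c x := by
    have h : toSubmodule (c • x) = algebraMap 𝕜 (LInfty 𝕜 μ) c • toSubmodule x := by
      apply Subtype.ext
      apply Subtype.ext
      show c • (x : S) = LInfty.toL0 𝕜 μ (algebraMap 𝕜 (LInfty 𝕜 μ) c) • (x : S)
      rw [toL0_algebraMap, algebraMap_smul]
    rw [h, map_smul]
    show LInfty.toL0 𝕜 μ (algebraMap 𝕜 (LInfty 𝕜 μ) c) * (f (toSubmodule x) : Ω →ₘ[μ] 𝕜) = _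
    rw [toL0_algebraMap, ← Algebra.smul_def]; rfl

theorem coeFn_map_smul (f : ModuleDual 𝕜 μ M) (η : LInfty 𝕜 μ) (x : M) :
    ∀ᵐ ω ∂μ, f (η • x) ω = LInfty.toL0 𝕜 μ η ω * f x ω := by
  rw [map_smul]
  exact coeFn_smul_Lp η (f x)

theorem coeFn_rn_smul_coe (η : LInfty 𝕜 μ) (x : M) :
    ∀ᵐ ω ∂μ, rn 𝕜 μ (((η • x : M) : LpRN 𝕜 μ S p) : S) ω =
      ‖LInfty.toL0 𝕜 μ η ω‖ * rn 𝕜 μ ((x : LpRN 𝕜 μ S p) : S) ω :=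
  coeFn_rn_smul (LInfty.toL0 𝕜 μ η) ((x : LpRN 𝕜 μ S p) : S)

/-- The `f x` with `‖x‖ ≤ 1` have upward directed moduli. -/
theorem exists_max_le_enorm (f : ModuleDual 𝕜 μ M)
    (x y : {x : M // ∀ᵐ ω ∂μ, rn 𝕜 μ ((x : LpRN 𝕜 μ S p) : S) ω ≤ 1}) :
    ∃ z : {x : M // ∀ᵐ ω ∂μ, rn 𝕜 μ ((x : LpRN 𝕜 μ S p) : S) ω ≤ 1},
      (fun ω => ‖f x.1 ω‖ₑ) ≤ᵐ[μ] (fun ω => ‖f z.1 ω‖ₑ) ∧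
      (fun ω => ‖f y.1 ω‖ₑ) ≤ᵐ[μ] (fun ω => ‖f z.1 ω‖ₑ) := by
  classical
  -- The upper bound is `1_A x + 1_{Aᶜ} y`, which selects at each point the larger of the two moduli
  -- and still has random norm at most `1`.
  let A : Set Ω := {ω | ‖f y.1 ω‖ ≤ ‖f x.1 ω‖}
  have hA : MeasurableSet A := measurableSet_le
    (f y.1 : Ω →ₘ[μ] 𝕜).measurable.norm (f x.1 : Ω →ₘ[μ] 𝕜).measurable.norm
  obtain ⟨η, hη⟩ := exists_LInfty_of_bound (μ := μ) (𝕜 := 𝕜) (h := A.indicator fun _ => 1) (C := 1)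
    (measurable_const.indicator hA) (fun ω => by by_cases h : ω ∈ A <;> simp [h])
  obtain ⟨θ, hθ⟩ := exists_LInfty_of_bound (μ := μ) (𝕜 := 𝕜) (h := Aᶜ.indicator fun _ => 1) (C := 1)
    (measurable_const.indicator hA.compl) (fun ω => by by_cases h : ω ∈ A <;> simp [h])
  have hz : ∀ᵐ ω ∂μ, rn 𝕜 μ (((η • x.1 + θ • y.1 : M) : LpRN 𝕜 μ S p) : S) ω ≤ 1 := by
    filter_upwards [coeFn_rn_add_le 𝕜 μ (((η • x.1 : M) : LpRN 𝕜 μ S p) : S)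
      (((θ • y.1 : M) : LpRN 𝕜 μ S p) : S), coeFn_rn_smul_coe η x.1, coeFn_rn_smul_coe θ y.1,
      hη, hθ, x.2, y.2] with ω h1 h2 h3 h4 h5 h6 h7
    refine h1.trans ?_
    rw [h2, h3, h4, h5]
    by_cases h : ω ∈ A <;> simpa [h]
  have hfz : ∀ᵐ ω ∂μ, f (η • x.1 + θ • y.1) ω =
      A.indicator (fun _ => 1) ω * f x.1 ω + Aᶜ.indicator (fun _ => 1) ω * f y.1 ω := by
    rw [map_add]
    filter_upwards [Lp.coeFn_add (f (η • x.1)) (f (θ • y.1)), coeFn_map_smul f η x.1,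
      coeFn_map_smul f θ y.1, hη, hθ] with ω h1 h2 h3 h4 h5
    rw [h1, Pi.add_apply, h2, h3, h4, h5]
  refine ⟨⟨_, hz⟩, ?_, ?_⟩
  · filter_upwards [hfz] with ω h1
    rw [h1, enorm_le_iff_norm_le]
    by_cases h : ω ∈ A
    · simp [h]
    · simpa [h] using (not_le.1 h).le
  · filter_upwards [hfz] with ω h1
    rw [h1, enorm_le_iff_norm_le]
    by_cases h : ω ∈ A
    · have h' : ‖f y.1 ω‖ ≤ ‖f x.1 ω‖ := h
      simpa [h] using h'
    · simp [h]

/-- A module homomorphism `f : M → L¹` is dominated by `ξ ‖x‖` with `|ξ|_q ≤ |||f|||`. -/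
theorem exists_dominating_weight [SigmaFinite μ] {q : ℝ≥0∞} (hpq : p⁻¹ + q⁻¹ = 1)
    (hq : q ≠ 0) (f : ModuleDual 𝕜 μ M) :
    ∃ ξ : Ω → ℝ, Measurable ξ ∧ (∀ ω, 0 ≤ ξ ω) ∧ eLpNorm ξ q μ ≤ moduleDualNorm f ∧
      ∀ x : M, ∀ᵐ ω ∂μ, ‖f x ω‖ ≤ ξ ω * rn 𝕜 μ ((x : LpRN 𝕜 μ S p) : S) ω := by
  have hN := norm_algebraMap_smul_coe M
  -- The ball is taken for the random norm, not for `|||·|||_p`, so that its essential supremum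
  -- dominates `f` pointwise.
  let B := {x : M // ∀ᵐ ω ∂μ, rn 𝕜 μ ((x : LpRN 𝕜 μ S p) : S) ω ≤ 1}
  have : Nonempty B := ⟨⟨0, by
    filter_upwards [coeFn_rn_zero (𝕜 := 𝕜) (μ := μ) (S := S)] with ω h
    exact h.trans_le zero_le_one⟩⟩
  have hgm : ∀ x : B, Measurable fun ω => ‖f x.1 ω‖ₑ := fun x =>
    (f x.1 : Ω →ₘ[μ] 𝕜).measurable.enorm
  obtain ⟨u, hu, huB⟩ := exists_seq_ae_le_iSup (μ := μ) (fun (x : B) ω => ‖f x.1 ω‖ₑ) hgm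
    (exists_max_le_enorm f)
  let G : Ω → ℝ≥0∞ := fun ω => ⨆ n, ‖f (u n).1 ω‖ₑ
  have hG : Measurable G := .iSup fun n => hgm _
  have hGq : eLpNorm G q μ ≤ moduleDualNorm f := by
    -- Test functions are bounded, hence act on `M` as elements of `L^∞`; since `‖u n‖ ≤ 1`, the
    -- random norm of `η (u n)` is at most `η`.
    refine eLpNorm_le_of_forall_lintegral_mul_le hpq hG fun η hη hC _ => ?_
    obtain ⟨C, hC⟩ := hC
    have h1 : ∫⁻ ω, η ω * G ω ∂μ = ⨆ n, ∫⁻ ω, η ω * ‖f (u n).1 ω‖ₑ ∂μ := by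
      simp only [G, ENNReal.mul_iSup]
      exact lintegral_iSup_ae (fun n => hη.coe_nnreal_ennreal.mul (hgm _))
        fun n => (hu n).mono fun ω h => mul_le_mul' le_rfl h
    rw [h1]
    refine iSup_le fun n => ?_
    obtain ⟨θ, hθ⟩ := exists_LInfty_of_bound (μ := μ) (𝕜 := 𝕜) (h := fun ω => ((η ω : ℝ) : 𝕜))
      (C := C) (RCLike.measurable_ofReal.comp hη.coe_nnreal_real) (fun ω => by
        rw [RCLike.norm_ofReal, NNReal.abs_eq]; exact_mod_cast hC ω)
    have h2 : ∫⁻ ω, η ω * ‖f (u n).1 ω‖ₑ ∂μ = ∫⁻ ω, ‖f (θ • (u n).1) ω‖ₑ ∂μ := by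
      refine lintegral_congr_ae ?_
      filter_upwards [coeFn_map_smul f θ (u n).1, hθ] with ω h3 h4
      rw [h3, h4, enorm_mul]
      congr 1
      rw [← ofReal_norm, RCLike.norm_ofReal, NNReal.abs_eq, ENNReal.ofReal_coe_nnreal]
    rw [h2]
    refine (lintegral_le_moduleDualNorm_mul hN f _).trans (mul_le_mul' le_rfl ?_)
    refine (LpRN.enorm_eq ((θ • (u n).1 : M) : LpRN 𝕜 μ S p)).trans_le ?_
    refine eLpNorm_mono_enorm_ae ?_
    filter_upwards [coeFn_rn_smul_coe θ (u n).1, hθ, (u n).2,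
      coeFn_rn_nonneg 𝕜 μ (((u n).1 : LpRN 𝕜 μ S p) : S)] with ω h3 h4 h5 h6
    rw [h3, h4, RCLike.norm_ofReal, NNReal.abs_eq, ← ofReal_norm,
      Real.norm_of_nonneg (mul_nonneg (η ω).coe_nonneg h6)]
    refine (ENNReal.ofReal_le_ofReal (mul_le_of_le_one_right (η ω).coe_nonneg h5)).trans_eq ?_
    exact ENNReal.ofReal_coe_nnreal
  have hGfin := ae_lt_top_of_eLpNorm_lt_top hq hG (hGq.trans_lt (moduleDualNorm_lt_top hN f))
  refine ⟨fun ω => (G ω).toReal, hG.ennreal_toReal, fun ω => ENNReal.toReal_nonneg, ?_,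
    fun x => ?_⟩
  · refine (eLpNorm_mono_enorm_ae (Eventually.of_forall fun ω => ?_)).trans hGq
    rw [← ofReal_norm, Real.norm_of_nonneg ENNReal.toReal_nonneg]
    exact ENNReal.ofReal_toReal_le
  -- The inverse of `‖x‖` may be unbounded or undefined, so `x` is normalised by `‖x‖ + ε` with `ε =
  -- 1 / (n + 1)`, whose inverse is at most `1 / ε`; then `n → ∞`.
  have key : ∀ n : ℕ, ∀ᵐ ω ∂μ, ‖f x ω‖ ≤
      (G ω).toReal * (rn 𝕜 μ ((x : LpRN 𝕜 μ S p) : S) ω + 1 / ((n : ℝ) + 1)) := by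
    intro n
    set r := rn 𝕜 μ ((x : LpRN 𝕜 μ S p) : S)
    have hε : (0 : ℝ) < 1 / ((n : ℝ) + 1) := by positivity
    set ε : ℝ := 1 / ((n : ℝ) + 1)
    have hpos : ∀ ω, 0 < |r ω| + ε := fun ω => by positivity
    have hrm : Measurable fun ω => (|r ω| + ε)⁻¹ := by
      have := r.measurable
      fun_prop
    obtain ⟨θ, hθ⟩ := exists_LInfty_of_bound (μ := μ) (𝕜 := 𝕜)
      (h := fun ω => (((|r ω| + ε)⁻¹ : ℝ) : 𝕜)) (C := ε⁻¹)
      (RCLike.measurable_ofReal.comp hrm) (fun ω => by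
        rw [RCLike.norm_ofReal, abs_of_pos (inv_pos.2 (hpos ω))]
        exact inv_anti₀ hε (le_add_of_nonneg_left (abs_nonneg _)))
    have hB : ∀ᵐ ω ∂μ, rn 𝕜 μ (((θ • x : M) : LpRN 𝕜 μ S p) : S) ω ≤ 1 := by
      filter_upwards [coeFn_rn_smul_coe θ x, hθ] with ω h1 h2
      rw [h1, h2, RCLike.norm_ofReal, abs_of_pos (inv_pos.2 (hpos ω)), inv_mul_le_one₀ (hpos ω)]
      exact (le_abs_self _).trans (le_add_of_nonneg_right hε.le)
    filter_upwards [huB ⟨_, hB⟩, coeFn_map_smul f θ x, hθ, hGfin,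
      coeFn_rn_nonneg 𝕜 μ ((x : LpRN 𝕜 μ S p) : S)] with ω h1 h2 h3 h4 h5
    have h6 : ‖f (θ • x) ω‖ ≤ (G ω).toReal := by
      rw [← toReal_enorm]
      exact ENNReal.toReal_mono h4.ne h1
    rw [h2, h3, norm_mul, RCLike.norm_ofReal, abs_of_pos (inv_pos.2 (hpos ω)),
      inv_mul_le_iff₀ (hpos ω), abs_of_nonneg h5, mul_comm] at h6
    exact h6
  filter_upwards [ae_all_iff.2 key] with ω hω
  have hT : Tendsto (fun n : ℕ => (G ω).toReal *
      (rn 𝕜 μ ((x : LpRN 𝕜 μ S p) : S) ω + 1 / ((n : ℝ) + 1))) atTop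
      (𝓝 ((G ω).toReal * (rn 𝕜 μ ((x : LpRN 𝕜 μ S p) : S) ω + 0))) :=
    (tendsto_const_nhds.add tendsto_one_div_add_atTop_nhds_zero_nat).const_mul _
  rw [add_zero] at hT
  exact ge_of_tendsto' hT hω

end Submodule

/-- The restriction of `F ∈ L^q(S*)` to `L^p(S)` is an element of the module dual. -/
theorem exists_moduleDual_eq [SigmaFinite μ] {p q : ℝ≥0∞} [Fact (1 ≤ p)] (hpq : p⁻¹ + q⁻¹ = 1)
    (F : RandomConj 𝕜 μ S) (hF : eLpNorm (conjNorm 𝕜 μ F) q μ < ∞) :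
    ∃ Φ : ModuleDual 𝕜 μ (LpRN 𝕜 μ S p), ∀ x : LpRN 𝕜 μ S p,
      (Φ x : Ω →ₘ[μ] 𝕜) = (F : S →ₗ[𝕜] (Ω →ₘ[μ] 𝕜)) (x : S) := by
  have hle := lintegral_enorm_le_conjNorm_mul (μ := μ) hpq F
  have hmem : ∀ x : LpRN 𝕜 μ S p, (F : S →ₗ[𝕜] (Ω →ₘ[μ] 𝕜)) (x : S) ∈ Lp 𝕜 1 μ := fun x => by
    rw [Lp.mem_Lp_iff_eLpNorm_lt_top, eLpNorm_one_eq_lintegral_enorm]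
    exact (hle x).trans_lt (ENNReal.mul_lt_top hF x.eLpNorm_lt_top)
  let Φ : LpRN 𝕜 μ S p →ₗ[LInfty 𝕜 μ] Lp 𝕜 1 μ :=
    { toFun := fun x => ⟨_, hmem x⟩
      map_add' := fun x y => Subtype.ext (map_add (F : S →ₗ[𝕜] (Ω →ₘ[μ] 𝕜)) (x : S) (y : S))
      -- A `𝕜`-linear map dominated by a multiple of the random norm is automatically `L⁰`-linear;
      -- here the weight is `‖F‖`.
      map_smul' := fun η x => Subtype.ext (map_smul_of_norm_le (V := (⊤ : Submodule 𝕜 S))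
        ((F : S →ₗ[𝕜] (Ω →ₘ[μ] 𝕜)) ∘ₗ Submodule.subtype ⊤)
        (fun x => ((mem_randomBounds_iff 𝕜 μ).1 (conjNorm_mem 𝕜 μ F)).2 x)
        (LInfty.toL0 𝕜 μ η) ⟨(x : S), trivial⟩ ⟨LInfty.toL0 𝕜 μ η • (x : S), trivial⟩ rfl) }
  refine ⟨⟨Φ, ?_⟩, fun x => rfl⟩
  refine AddMonoidHomClass.continuous_of_bound Φ (eLpNorm (conjNorm 𝕜 μ F) q μ).toReal fun x => ?_
  show (eLpNorm _ 1 μ).toReal ≤ _ * (eLpNorm _ p μ).toReal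
  rw [← ENNReal.toReal_mul, eLpNorm_one_eq_lintegral_enorm]
  exact ENNReal.toReal_mono (ENNReal.mul_lt_top hF x.eLpNorm_lt_top).ne (hle x)

/-- Every module homomorphism on a submodule of `L^p(S)` is the restriction of some `F ∈ S*` with
`|‖F‖|_q ≤ |||f|||`. -/
theorem exists_randomConj_extension [SigmaFinite μ] {p q : ℝ≥0∞} [Fact (1 ≤ p)]
    (hpq : p⁻¹ + q⁻¹ = 1) (hq : q ≠ 0) {M : Submodule (LInfty 𝕜 μ) (LpRN 𝕜 μ S p)}
    (f : ModuleDual 𝕜 μ M) :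
    ∃ F : RandomConj 𝕜 μ S, eLpNorm (conjNorm 𝕜 μ F) q μ ≤ moduleDualNorm f ∧
      ∀ x : M, (F : S →ₗ[𝕜] (Ω →ₘ[μ] 𝕜)) ((x : LpRN 𝕜 μ S p) : S) = (f x : Ω →ₘ[μ] 𝕜) := by
  obtain ⟨ξ, hξ, hξ0, hξq, hfξ⟩ := exists_dominating_weight hpq hq f
  have hfin : moduleDualNorm f < ∞ := moduleDualNorm_lt_top (norm_algebraMap_smul_coe M) f
  -- By Hölder's inequality, `ξ ∈ L^q` and `‖x‖ ∈ L^p` make `ξ ‖x‖` integrable.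
  have hW : carrierSubmodule M ≤ weightedL1 𝕜 μ S hξ hξ0 := by
    rintro x ⟨hx, -⟩
    have : ENNReal.HolderTriple q p 1 := ⟨by rw [add_comm, hpq, inv_one]⟩
    have h1 : MemLp (ξ • ⇑(rn 𝕜 μ x)) 1 μ := MemLp.smul (p := q) (q := p)
      ⟨(rn 𝕜 μ x).aestronglyMeasurable, hx⟩ ⟨hξ.aestronglyMeasurable, hξq.trans_lt hfin⟩
    exact memLp_one_iff_integrable.1 h1
  obtain ⟨F, hFf, hF⟩ := exists_extension_of_norm_le hξ hξ0 hW (ModuleDual.toLinearMap f)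
    (fun x => hfξ (toSubmodule x)) (fun A hA x => by
      obtain ⟨hx, hx'⟩ := x.2
      have h1 : ind 𝕜 μ hA ∈ linftySubalgebra 𝕜 μ := by
        show eLpNorm _ ∞ μ < ∞
        rw [eLpNorm_exponent_top]
        exact eLpNormEssSup_lt_top_of_ae_bound (norm_ind_le hA)
      exact ⟨_, M.smul_mem (show LInfty 𝕜 μ from
        (⟨ind 𝕜 μ hA, h1⟩ : linftySubalgebra 𝕜 μ)) hx'⟩)
  have hξae : ∀ᵐ ω ∂μ, AEEqFun.mk ξ hξ.aestronglyMeasurable ω = ξ ω := AEEqFun.coeFn_mk _ _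
  -- The class of `ξ` competes in the infimum defining `‖F‖`, so `‖F‖ ≤ ξ` and the `L^q` bound
  -- passes to `‖F‖`.
  have hξB : AEEqFun.mk ξ hξ.aestronglyMeasurable ∈ randomBounds 𝕜 μ F := by
    refine (mem_randomBounds_iff 𝕜 μ).2 ⟨?_, fun x => ?_⟩
    · filter_upwards [hξae] with ω h
      rw [h]; exact hξ0 ω
    · filter_upwards [hξae, hF x] with ω h1 h2
      rwa [h1]
  refine ⟨⟨F, _, hξB⟩, le_trans (eLpNorm_mono_ae ?_) hξq,
    fun x => hFf ⟨_, (x : LpRN 𝕜 μ S p).2, x.2⟩⟩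
  filter_upwards [AEEqFun.coeFn_le.2 ((isGLB_conjNorm 𝕜 μ ⟨F, _, hξB⟩).1 hξB), hξae,
    ((mem_randomBounds_iff 𝕜 μ).1 (conjNorm_mem 𝕜 μ ⟨F, _, hξB⟩)).1] with ω h1 h2 h3
  rw [h2] at h1
  rw [Real.norm_of_nonneg h3, Real.norm_of_nonneg (hξ0 ω)]
  exact h1

end ModuleDual

end RandomNormed

theorem proposition3p13 {Ω : Type*} [MeasurableSpace Ω] (μ : Measure Ω) [SigmaFinite μ] [NeZero μ]
    {𝕜 : Type*} [RCLike 𝕜]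
    {S : Type*} [AddCommGroup S] [Module 𝕜 S] [Module (Ω →ₘ[μ] 𝕜) S]
    [IsScalarTower 𝕜 (Ω →ₘ[μ] 𝕜) S] [RNModule 𝕜 μ S]
    (hS : EpsLambdaComplete 𝕜 μ S)
    (p q : ℝ≥0∞) [Fact (1 ≤ p)] [Fact (1 ≤ q)] (hpq : p⁻¹ + q⁻¹ = 1)
    (M : Submodule (LInfty 𝕜 μ) (LpRN 𝕜 μ S p)) (f : ModuleDual 𝕜 μ M) :
    ∃ (F : LpRN 𝕜 μ (RandomConj 𝕜 μ S) q) (Φ : ModuleDual 𝕜 μ (LpRN 𝕜 μ S p)),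
      -- `F ∈ L^q(S*)` and `Φ ∈ (L^p(S))*_m` are the same map on `L^p(S)`
      (∀ x : LpRN 𝕜 μ S p,
        (Φ x : Ω →ₘ[μ] 𝕜) =
          ((F : RandomConj 𝕜 μ S) : S →ₗ[𝕜] (Ω →ₘ[μ] 𝕜)) (x : S)) ∧
      (∀ x : M, Φ (x : LpRN 𝕜 μ S p) = f x) ∧
      ENNReal.ofReal ‖F‖ = moduleDualNorm f ∧
      moduleDualNorm Φ = moduleDualNorm f := by
  have hq0 : q ≠ 0 := (zero_lt_one.trans_le (Fact.out : 1 ≤ q)).ne'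
  obtain ⟨F', hF'q, hFf⟩ := exists_randomConj_extension hpq hq0 f
  have hfin : moduleDualNorm f < ∞ := moduleDualNorm_lt_top (norm_algebraMap_smul_coe M) f
  obtain ⟨Φ, hΦ⟩ := exists_moduleDual_eq hpq F' (hF'q.trans_lt hfin)
  have hΦf : ∀ x : M, Φ (x : LpRN 𝕜 μ S p) = f x := fun x =>
    Subtype.ext ((hΦ x).trans (hFf x))
  -- The cycle `|||f||| ≤ |||Φ||| ≤ |‖F‖|_q ≤ |||f|||` forces equality: the first inequality is
  -- restriction of the unit ball, the second Hölder's, the third the bound on the extension.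
  have hfΦ : moduleDualNorm f ≤ moduleDualNorm Φ := iSup_le fun x => by
    rw [← hΦf x.1]
    exact le_moduleDualNorm Φ (x := (x.1 : LpRN 𝕜 μ S p)) x.2
  have hΦF : moduleDualNorm Φ ≤ eLpNorm (conjNorm 𝕜 μ F') q μ := iSup_le fun x => by
    have h1 := lintegral_enorm_le_conjNorm_mul hpq F' (x.1 : S)
    rw [← hΦ, ← LpRN.enorm_eq] at h1
    refine h1.trans (mul_le_of_le_one_right' ?_)
    rw [← ofReal_norm]
    exact ENNReal.ofReal_le_one.2 x.2
  let F'' : LpRN 𝕜 μ (RandomConj 𝕜 μ S) q :=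
    (⟨F', hF'q.trans_lt hfin⟩ : lpAddSubgroup 𝕜 μ (RandomConj 𝕜 μ S) q)
  have hnorm : ENNReal.ofReal ‖F''‖ = eLpNorm (conjNorm 𝕜 μ F') q μ :=
    (ofReal_norm F'').trans (LpRN.enorm_eq F'')
  exact ⟨F'', Φ, hΦ, hΦf, hnorm.trans (le_antisymm hF'q (hfΦ.trans hΦF)),
    le_antisymm (hΦF.trans hF'q) hfΦ⟩
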